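/- For $p\in[0,1]$ let $\mu_p$ be the Bernoulli measure on $2^\omega$ given by $\mu_p(\llbracket\sigma\rrbracket)=p^{\#_0(\sigma)}(1-p)^{\#_1(\sigma)}$, where $\llbracket\sigma\rrbracket$ is the set of infinite binary sequences extending the finite string $\sigma$ and $\#_i(\sigma)$ is the number of occurrences of $i$ in $\sigma$. A sequence $x\in 2^\omega$ is Bernoulli $p$-random if $x\notin\bigcap_i\mathcal U_i$ for every sequence $(\mathcal U_i)_{i\in\omega}$ that is uniformly $\Sigma^0_1$ relative to (the binary expansion of) $p$ and satisfies $\mu_p(\mathcal U_i)\le 2^{-i}$ for all $i$. A sequence $y\in 2^\omega$ is Martin-Löf random if $y\notin\bigcap_i\mathcal U_i$ for every uniformly $\Sigma^0_1$ sequence $(\mathcal U_i)_{i\in\omega}$ with $\lambda(\mathcal U_i)\le 2^{-i}$ for all $i$, where $\lambda$ is the Lebesgue measure, $\lambda(\llbracket\sigma\rrbracket)=2^{-|\sigma|}$. **Theorem.** For every $p\in(0,1)$ there are a Bernoulli $p$-random sequence $x\in2^\omega$ and a Martin-Löf random sequence $y\in2^\omega$ that are Turing equivalent, $x\equiv_T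 y$. -/

import Mathlib

open MeasureTheory
open scoped ENNReal

noncomputable section

namespace BernoulliRandomness

/-- Cantor space `2^ω`; the bit `0` is `false` and the bit `1` is `true`. -/
abbrev Cantor : Type := ℕ → Bool

/-- The basic clopen set `⟦σ⟧` of all sequences that extend the finite string `σ`. -/
def cylinder (σ : List Bool) : Set Cantor :=
  {x | ∀ (i : ℕ) (h : i < σ.length), x i = σ[i]}

/-- The Bernoulli measure `μ_p` on Cantor space: the bits are independent, and each of them is
`0` with probability `p` and `1` with probability `1 - p`. -/
def bernoulli (p : unitInterval) : Measure Cantor :=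
  Measure.infinitePi fun _ : ℕ => ProbabilityTheory.bernoulliMeasure false true p

/-- The Lebesgue (fair coin) measure on Cantor space. -/
def lebesgue : Measure Cantor :=
  bernoulli ⟨1 / 2, by norm_num, by norm_num⟩

/-- A binary sequence as an oracle. -/
def oracle (x : Cantor) : ℕ →. ℕ := fun n => Part.some (x n).toNat

/-- Turing equivalence of binary sequences. -/
def TuringEquiv (x y : Cantor) : Prop := TuringEquivalent (oracle x) (oracle y)

/-- The binary expansion of a real in `[0, 1]`, through which a real is used as an oracle: the
`n`-th bit is the parity of `⌊p * 2 ^ (n + 1)⌋` (so a dyadic rational below `1` gets its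
expansion that ends in zeros). -/
def binaryExpansion (p : unitInterval) : Cantor :=
  fun n => decide (Real.digits (p : ℝ) 2 n = 1)

/-- `U` is a uniformly effectively open sequence of subsets of Cantor space, relative to the
oracles in `O`: some total `O`-computable function enumerates, for each `i`, strings
(the value `none` standing for no string at this stage) whose cylinders have union `U i`. -/
def UniformlySigma1In (O : Set (ℕ →. ℕ)) (U : ℕ → Set Cantor) : Prop :=
  ∃ f : ℕ → ℕ → Option (List Bool), ComputableIn₂ O f ∧
    ∀ i, U i = {x | ∃ s σ, f i s = some σ ∧ x ∈ cylinder σ}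

/-- A `μ`-Martin-Löf test relative to the oracles in `O`. -/
def IsMLTest (μ : Measure Cantor) (O : Set (ℕ →. ℕ)) (U : ℕ → Set Cantor) : Prop :=
  UniformlySigma1In O U ∧ ∀ i, μ (U i) ≤ (2⁻¹ : ℝ≥0∞) ^ i

/-- `x` passes every `μ`-Martin-Löf test relative to the oracles in `O`. -/
def PassesMLTests (μ : Measure Cantor) (O : Set (ℕ →. ℕ)) (x : Cantor) : Prop :=
  ∀ U : ℕ → Set Cantor, IsMLTest μ O U → x ∉ ⋂ i, U i

/-- Martin-Löf random sequences: random for Lebesgue measure, without an oracle. -/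
def MLRandom (x : Cantor) : Prop := PassesMLTests lebesgue ∅ x

/-- Bernoulli `p`-random sequences: those that pass every `μ_p`-Martin-Löf test relative to
the oracle `p`. -/
def BernoulliRandom (p : unitInterval) (x : Cantor) : Prop :=
  PassesMLTests (bernoulli p) {oracle (binaryExpansion p)} x

/-- The values `μ_p(⟦σ⟧) = p ^ #₀(σ) * (1 - p) ^ #₁(σ)`. -/
theorem bernoulli_cylinder (p : unitInterval) (σ : List Bool) :
    bernoulli p (cylinder σ) =
      ENNReal.ofReal ((p : ℝ) ^ σ.count false * (1 - (p : ℝ)) ^ σ.count true) := by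
  have hcyl : cylinder σ =
      Set.pi (Finset.range σ.length) fun i => {b : Bool | b = σ.getD i false} := by
    ext x
    simp only [cylinder, Set.mem_ofPred_eq, Set.mem_pi, Finset.coe_range, Set.mem_Iio]
    refine forall_congr' fun i => forall_congr' fun h => ?_
    simp [h]
  have hb : ∀ b : Bool, ProbabilityTheory.bernoulliMeasure false true p {c : Bool | c = b} =
      ENNReal.ofReal (if b = false then (p : ℝ) else 1 - (p : ℝ)) := by
    intro b
    have h0 : ((unitInterval.toNNReal p : NNReal) : ℝ≥0∞) = ENNReal.ofReal (p : ℝ) := by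
      rw [ENNReal.ofReal, Real.toNNReal_of_nonneg p.2.1]
      rfl
    have h1 : ((unitInterval.toNNReal (unitInterval.symm p) : NNReal) : ℝ≥0∞) =
        ENNReal.ofReal (1 - (p : ℝ)) := by
      rw [ENNReal.ofReal, Real.toNNReal_of_nonneg (sub_nonneg.2 p.2.2)]
      rfl
    classical
    rw [ProbabilityTheory.bernoulliMeasure_apply p MeasurableSet.of_discrete]
    cases b <;> simp [h0, h1]
  rw [hcyl, bernoulli, Measure.infinitePi_pi _ (fun i _ => MeasurableSet.of_discrete)]
  simp only [hb]
  rw [← ENNReal.ofReal_prod_of_nonneg (fun i _ => by split_ifs <;> [exact p.2.1; linarith [p.2.2]])]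
  congr 1
  clear hcyl
  induction σ with
  | nil => simp
  | cons b σ ih =>
    rw [List.length_cons, Finset.prod_range_succ']
    simp only [List.getD_cons_succ, List.getD_cons_zero, ih]
    cases b <;> simp [pow_succ] <;> ring

theorem lebesgue_cylinder (σ : List Bool) : lebesgue (cylinder σ) = (2⁻¹ : ℝ≥0∞) ^ σ.length := by
  rw [lebesgue, bernoulli_cylinder]
  have h : σ.length = σ.count false + σ.count true := by
    induction σ with
    | nil => rfl
    | cons b σ ih => cases b <;> simp <;> omega
  have h2 : (1 : ℝ) - 1 / 2 = 2⁻¹ := by norm_num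
  have h3 : (1 : ℝ) / 2 = 2⁻¹ := by norm_num
  simp only [h2]
  rw [h3, ← pow_add, ← h, ENNReal.ofReal_pow (by norm_num), ENNReal.ofReal_inv_of_pos (by norm_num)]
  simp

end BernoulliRandomness

end

namespace BernoulliRandomness

/-! ### Initial segments and the use principle -/

/-! The two sequences are built side by side by finite extensions, each coding the other in the
manner of Kučera and Gács. The construction treats two parameters `p` and `q` symmetrically; the
theorem is the case `q = 1/2`. It need not be effective: only the decoding must be.

Each sequence carries a string `σ` and the history `h` of the bits coded so far. The bit at an even
place `2 * e` says whether the `e`-th sequence of sets effectively open in `p` is a `μ_p`-test; if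
it is, one of its components becomes forbidden from then on. The bits at odd places are the
successive bits of the partner. The history thus tells a decoder which open set is being avoided,
although being a test is not a decidable property.

To code a bit, the string grows from length `l = K ^ (n + 1)` to `l' = K ^ (n + 2)`, where `K = 4 *
N` and `N` bounds `1 / p` and `1 / (1 - p)`. The invariant is that the cylinder of `σ` has measure
at least `2 ^ (-2 * l)` outside the forbidden set. An extension is declared dead when a finite part
of `p` shows that less than `4 * 2 ^ (-2 * l')` of it is left. All the dead extensions together
carry little, and a single extension has measure at most `2 ^ (-4 * l)`, so at least two never die
(`one_lt_card_not_dead`). The one with the least code represents the bit `0`, the one with the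
greatest code the bit `1`. A decoder that knows `p` waits until all smaller or all larger
competitors are dead; exactly one of these happens (`Position.exists_next`). A string that never
dies keeps at least `2 * 2 ^ (-2 * l')` (`le_measure_of_forall_not_dead`), so forbidding one more
component of measure at most `2 ^ (-2 * l')` restores the invariant.

Decoding needs `p`, and the coding sequence supplies it. By Chebyshev's inequality some test forces
the frequency of `0` to converge to `p` at a known rate (`exists_frequency_test`), so a sequence
avoiding it computes `p` (`exists_expansion_certificate`). It then recovers its whole history bit by
bit, and the partner with it (`CodingPath.recursiveIn_limitSeq`). Randomness holds because every
test is eventually avoided (`CodingPath.limitSeq_notMem`). -/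

/-- The finite initial segment of length `k` of a binary sequence. -/
def initSeg (x : Cantor) (k : ℕ) : List Bool := (List.range k).map x

@[simp] theorem length_initSeg (x : Cantor) (k : ℕ) : (initSeg x k).length = k := by
  simp [initSeg]

theorem take_initSeg (x : Cantor) {j k : ℕ} (h : j ≤ k) :
    (initSeg x k).take j = initSeg x j := by
  simp [initSeg, ← List.map_take, List.take_range, h]

theorem initSeg_prefix (x : Cantor) {j k : ℕ} (h : j ≤ k) : initSeg x j <+: initSeg x k := by
  rw [← take_initSeg x h]; exact List.take_prefix _ _

theorem initSeg_succ (x : Cantor) (k : ℕ) : initSeg x (k + 1) = initSeg x k ++ [x k] := by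
  simp [initSeg, List.range_succ]

theorem getElem?_initSeg (x : Cantor) {i k : ℕ} (h : i < k) : (initSeg x k)[i]? = some (x i) := by
  simp [initSeg, h]

theorem mem_cylinder_iff (x : Cantor) (σ : List Bool) :
    x ∈ cylinder σ ↔ initSeg x σ.length = σ := by
  constructor
  · intro h
    refine List.ext_getElem (by simp) fun i h₁ h₂ => ?_
    simpa [initSeg] using h i h₂
  · intro h i hi
    have : (initSeg x σ.length)[i]'(by simpa using hi) = σ[i] := by congr 1
    simpa [initSeg] using this

theorem mem_cylinder_iff_prefix (x : Cantor) (σ : List Bool) {k : ℕ} (hk : σ.length ≤ k) :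
    x ∈ cylinder σ ↔ σ <+: initSeg x k := by
  rw [mem_cylinder_iff, List.prefix_iff_eq_take, take_initSeg x hk, eq_comm]

/-- A partial function recursive in a binary sequence is the limit of a partial recursive
function of the initial segments of that sequence. -/
theorem exists_partrec_of_recursiveIn {x : Cantor} {f : ℕ →. ℕ}
    (hf : Nat.RecursiveIn {oracle x} f) :
    ∃ φ : List Bool → ℕ →. ℕ, Partrec₂ φ ∧
      (∀ σ τ n m, σ <+: τ → m ∈ φ σ n → m ∈ φ τ n) ∧
      ∀ n m, m ∈ f n ↔ ∃ k, m ∈ φ (initSeg x k) n := by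
  induction hf with
  | zero =>
    refine ⟨fun _ _ => Part.some 0, (Computable.const 0).partrec, by simp, ?_⟩
    intro n m
    exact ⟨fun h => ⟨0, h⟩, fun ⟨_, h⟩ => h⟩
  | succ =>
    exact ⟨fun _ n => Part.some n.succ, (Computable.succ.comp Computable.snd).partrec, by simp,
      by simp⟩
  | left =>
    exact ⟨fun _ n => Part.some n.unpair.1,
      (Computable.fst.comp (Computable.unpair.comp Computable.snd)).partrec, by simp,
      by simp⟩
  | right =>
    exact ⟨fun _ n => Part.some n.unpair.2,
      (Computable.snd.comp (Computable.unpair.comp Computable.snd)).partrec, by simp,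
      by simp⟩
  | oracle g hg =>
    obtain rfl := hg
    refine ⟨fun σ n => ((σ[n]?).map Bool.toNat : Option ℕ), ?_, ?_, ?_⟩
    · refine Computable.ofOption (Primrec.to_comp ?_)
      exact Primrec.option_map Primrec.list_getElem? ((Primrec.dom_bool _).comp Primrec.snd)
    · intro σ τ n m h hm
      simp only [Part.mem_ofOption, Option.mem_def, Option.map_eq_some_iff] at hm ⊢
      obtain ⟨a, ha, rfl⟩ := hm
      obtain ⟨r, rfl⟩ := h
      exact ⟨a, by rw [List.getElem?_append_left (List.getElem?_eq_some_iff.1 ha).1, ha], rfl⟩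
    · intro n m
      simp only [oracle, Part.mem_some_iff, Part.mem_ofOption, Option.mem_def,
        Option.map_eq_some_iff]
      constructor
      · rintro rfl
        exact ⟨n + 1, x n, getElem?_initSeg x (Nat.lt_succ_self n), rfl⟩
      · rintro ⟨k, a, ha, rfl⟩
        have hk : n < k := by simpa using (List.getElem?_eq_some_iff.1 ha).1
        rw [getElem?_initSeg x hk] at ha
        cases ha; rfl
  | @pair f h _ _ ihf ihh =>
    obtain ⟨φ, hφ, mφ, lφ⟩ := ihf
    obtain ⟨ψ, hψ, mψ, lψ⟩ := ihh
    refine ⟨fun σ n => (φ σ n).bind fun a => (ψ σ n).map fun b => Nat.pair a b, ?_, ?_, ?_⟩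
    · refine Partrec.bind hφ ?_
      refine Partrec.map (hψ.comp (Computable.fst.comp Computable.fst)
        (Computable.snd.comp Computable.fst)) ?_
      exact (Primrec₂.natPair.to_comp.comp (Computable.snd.comp Computable.fst) Computable.snd)
    · intro σ τ n m h hm
      simp only [Part.mem_bind_iff, Part.mem_map_iff] at hm ⊢
      obtain ⟨a, ha, b, hb, rfl⟩ := hm
      exact ⟨a, mφ _ _ _ _ h ha, b, mψ _ _ _ _ h hb, rfl⟩
    · intro n m
      simp only [Seq.seq, Part.map_eq_map, Part.mem_bind_iff, Part.mem_map_iff, lφ, lψ]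
      constructor
      · rintro ⟨_, ⟨a, ⟨k, hk⟩, rfl⟩, b, ⟨l, hl⟩, rfl⟩
        exact ⟨max k l, a, mφ _ _ _ _ (initSeg_prefix x (le_max_left _ _)) hk, b,
          mψ _ _ _ _ (initSeg_prefix x (le_max_right _ _)) hl, rfl⟩
      · rintro ⟨k, a, ha, b, hb, rfl⟩
        exact ⟨_, ⟨a, ⟨k, ha⟩, rfl⟩, b, ⟨k, hb⟩, rfl⟩
  | @comp f h _ _ ihf ihh =>
    obtain ⟨φ, hφ, mφ, lφ⟩ := ihf
    obtain ⟨ψ, hψ, mψ, lψ⟩ := ihh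
    refine ⟨fun σ n => (ψ σ n).bind fun a => φ σ a, ?_, ?_, ?_⟩
    · exact Partrec.bind hψ (hφ.comp (Computable.fst.comp Computable.fst) Computable.snd)
    · intro σ τ n m h hm
      simp only [Part.mem_bind_iff] at hm ⊢
      obtain ⟨a, ha, hb⟩ := hm
      exact ⟨a, mψ _ _ _ _ h ha, mφ _ _ _ _ h hb⟩
    · intro n m
      refine Part.mem_bind_iff.trans ?_
      simp only [Part.mem_bind_iff, lφ, lψ]
      constructor
      · rintro ⟨a, ⟨k, hk⟩, ⟨l, hl⟩⟩
        exact ⟨max k l, a, mψ _ _ _ _ (initSeg_prefix x (le_max_left _ _)) hk,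
          mφ _ _ _ _ (initSeg_prefix x (le_max_right _ _)) hl⟩
      · rintro ⟨k, a, ha, hb⟩
        exact ⟨_, ⟨k, ha⟩, ⟨k, hb⟩⟩
  | @prec f h _ _ ihf ihh =>
    obtain ⟨φ, hφ, mφ, lφ⟩ := ihf
    obtain ⟨ψ, hψ, mψ, lψ⟩ := ihh
    refine ⟨fun σ p => p.unpair.2.rec (φ σ p.unpair.1) fun y IH => IH.bind fun i =>
      ψ σ (Nat.pair p.unpair.1 (Nat.pair y i)), ?_, ?_, ?_⟩
    · have hu : Computable fun a : List Bool × ℕ => a.2.unpair :=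
        Computable.unpair.comp Computable.snd
      refine Partrec.nat_rec (f := fun a : List Bool × ℕ => a.2.unpair.2)
        (g := fun a => φ a.1 a.2.unpair.1)
        (h := fun a b => ψ a.1 (Nat.pair a.2.unpair.1 (Nat.pair b.1 b.2))) ?_ ?_ ?_
      · exact Computable.snd.comp hu
      · exact hφ.comp Computable.fst (Computable.fst.comp hu)
      · refine hψ.comp (Computable.fst.comp Computable.fst) ?_
        refine Primrec₂.natPair.to_comp.comp (Computable.fst.comp (hu.comp Computable.fst)) ?_
        exact Primrec₂.natPair.to_comp.comp (Computable.fst.comp Computable.snd)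
          (Computable.snd.comp Computable.snd)
    · have key : ∀ (σ τ : List Bool) (a n m : ℕ), σ <+: τ →
          m ∈ (n.rec (φ σ a) fun y IH => IH.bind fun i => ψ σ (Nat.pair a (Nat.pair y i)) :
            Part ℕ) →
          m ∈ (n.rec (φ τ a) fun y IH => IH.bind fun i => ψ τ (Nat.pair a (Nat.pair y i)) :
            Part ℕ) := by
        intro σ τ a n m h
        induction n generalizing m with
        | zero => exact mφ _ _ _ _ h
        | succ n ih =>
          simp only [Part.mem_bind_iff]
          rintro ⟨i, hi, hm⟩
          exact ⟨i, ih _ hi, mψ _ _ _ _ h hm⟩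
      intro σ τ n m h
      exact key σ τ _ _ m h
    · intro p m
      dsimp only
      generalize p.unpair.1 = a
      have mono : ∀ n m j k : ℕ, j ≤ k →
          m ∈ (n.rec (φ (initSeg x j) a) fun y IH => IH.bind fun i =>
            ψ (initSeg x j) (Nat.pair a (Nat.pair y i)) : Part ℕ) →
          m ∈ (n.rec (φ (initSeg x k) a) fun y IH => IH.bind fun i =>
            ψ (initSeg x k) (Nat.pair a (Nat.pair y i)) : Part ℕ) := by
        intro n m j k h
        induction n generalizing m with
        | zero => exact mφ _ _ _ _ (initSeg_prefix x h)
        | succ n ih =>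
          simp only [Part.mem_bind_iff]
          rintro ⟨i, hi, hm⟩
          exact ⟨i, ih _ hi, mψ _ _ _ _ (initSeg_prefix x h) hm⟩
      induction p.unpair.2 generalizing m with
      | zero => exact lφ _ _
      | succ n ih =>
        simp only [Part.bind_eq_bind, Part.mem_bind_iff, lψ] at ih ⊢
        constructor
        · rintro ⟨i, hi, l, hl⟩
          obtain ⟨k, hk⟩ := (ih i).1 hi
          exact ⟨max k l, i, mono _ _ _ _ (le_max_left _ _) hk,
            mψ _ _ _ _ (initSeg_prefix x (le_max_right _ _)) hl⟩
        · rintro ⟨k, i, hi, hl⟩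
          exact ⟨i, (ih i).2 ⟨k, hi⟩, k, hl⟩
  | @rfind f _ ihf =>
    obtain ⟨φ, hφ, mφ, lφ⟩ := ihf
    refine ⟨fun σ a => Nat.rfind fun n => (φ σ (Nat.pair a n)).map fun m => decide (m = 0),
      ?_, ?_, ?_⟩
    · refine Partrec.rfind (p := fun (a : List Bool × ℕ) n =>
        (φ a.1 (Nat.pair a.2 n)).map fun m => decide (m = 0)) ?_
      refine Partrec.map (hφ.comp (Computable.fst.comp Computable.fst) ?_) ?_
      · exact Primrec₂.natPair.to_comp.comp (Computable.snd.comp Computable.fst) Computable.snd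
      · exact ((Primrec.eq.comp Primrec.snd (Primrec.const 0)).decide).to_comp
    · intro σ τ n m h hm
      obtain ⟨h₁, h₂⟩ := Nat.mem_rfind.1 hm
      obtain ⟨a, ha, ha0⟩ := (Part.mem_map_iff _).1 h₁
      refine Nat.mem_rfind.2 ⟨(Part.mem_map_iff _).2 ⟨a, mφ _ _ _ _ h ha, ha0⟩, fun {j} hj => ?_⟩
      obtain ⟨a, ha, h0⟩ := (Part.mem_map_iff _).1 (h₂ hj)
      exact (Part.mem_map_iff _).2 ⟨a, mφ _ _ _ _ h ha, h0⟩
    · intro n m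
      constructor
      · intro hm
        obtain ⟨h₁, h₂⟩ := Nat.mem_rfind.1 hm
        obtain ⟨a, ha, ha0⟩ := (Part.mem_map_iff _).1 h₁
        obtain ⟨k, hk⟩ := (lφ _ _).1 ha
        -- The search evaluates only finitely many values before it stops, so one initial segment of
        -- `x` serves for all of them.
        have : ∃ K, ∀ j < m, ∃ a ∈ φ (initSeg x K) (Nat.pair n j), decide (a = 0) = false := by
          have h₃ : ∀ j < m, ∃ a ∈ f (Nat.pair n j), decide (a = 0) = false := fun j hj =>
            (Part.mem_map_iff _).1 (h₂ hj)
          clear hm h₁ h₂ hk ha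
          induction m with
          | zero => exact ⟨0, by simp⟩
          | succ m ih =>
            obtain ⟨a, ha, h0⟩ := h₃ m (Nat.lt_succ_self m)
            obtain ⟨l, ha⟩ := (lφ _ _).1 ha
            obtain ⟨K, hK⟩ := ih fun j hj => h₃ j (Nat.lt_succ_of_lt hj)
            refine ⟨max K l, fun j hj => ?_⟩
            rcases Nat.lt_succ_iff_lt_or_eq.1 hj with hj | rfl
            · obtain ⟨b, hb, hb0⟩ := hK j hj
              exact ⟨b, mφ _ _ _ _ (initSeg_prefix x (le_max_left _ _)) hb, hb0⟩
            · exact ⟨a, mφ _ _ _ _ (initSeg_prefix x (le_max_right _ _)) ha, h0⟩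
        obtain ⟨K, hK⟩ := this
        refine ⟨max k K, Nat.mem_rfind.2 ⟨(Part.mem_map_iff _).2
          ⟨a, mφ _ _ _ _ (initSeg_prefix x (le_max_left _ _)) hk, ha0⟩, fun {j} hj => ?_⟩⟩
        obtain ⟨b, hb, hb0⟩ := hK j hj
        exact (Part.mem_map_iff _).2
          ⟨b, mφ _ _ _ _ (initSeg_prefix x (le_max_right _ _)) hb, hb0⟩
      · rintro ⟨k, hm⟩
        obtain ⟨h₁, h₂⟩ := Nat.mem_rfind.1 hm
        obtain ⟨a, ha, ha0⟩ := (Part.mem_map_iff _).1 h₁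
        refine Nat.mem_rfind.2 ⟨(Part.mem_map_iff _).2 ⟨a, (lφ _ _).2 ⟨k, ha⟩, ha0⟩,
          fun {j} hj => ?_⟩
        obtain ⟨a, ha, h0⟩ := (Part.mem_map_iff _).1 (h₂ hj)
        exact (Part.mem_map_iff _).2 ⟨a, (lφ _ _).2 ⟨k, ha⟩, h0⟩

/-! ### Total functions recursive in a sequence -/

section Total

variable {O : Set (ℕ →. ℕ)} {f g : ℕ → ℕ}

theorem recursiveIn_comp_total (hf : Nat.RecursiveIn O fun n => Part.some (f n))
    (hg : Nat.RecursiveIn O fun n => Part.some (g n)) :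
    Nat.RecursiveIn O fun n => Part.some (f (g n)) :=
  (Nat.RecursiveIn.comp hf hg).of_eq fun n => Part.bind_some (g n) fun n => Part.some (f n)

theorem recursiveIn_pair_total (hf : Nat.RecursiveIn O fun n => Part.some (f n))
    (hg : Nat.RecursiveIn O fun n => Part.some (g n)) :
    Nat.RecursiveIn O fun n => Part.some (Nat.pair (f n) (g n)) :=
  (Nat.RecursiveIn.pair hf hg).of_eq fun n => by simp [Seq.seq]

theorem recursiveIn_natRec_total (a : ℕ) (hf : Nat.RecursiveIn O fun n => Part.some (f n)) :
    Nat.RecursiveIn O fun n =>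
      Part.some (Nat.rec (motive := fun _ => ℕ) a (fun y i => f (Nat.pair y i)) n) := by
  -- Primitive recursion expects a parameter paired with the recursion variable; the dummy parameter
  -- `0` is dropped again by `hr`.
  have h₀ : Nat.RecursiveIn O fun n => Part.some (Nat.pair 0 n) :=
    (Primrec.nat_iff.1 (Primrec₂.natPair.comp (Primrec.const 0) Primrec.id)).recursiveIn
  have hr : Nat.RecursiveIn O fun n => Part.some n.unpair.2 := .right
  have ha : Nat.RecursiveIn O fun _ => Part.some a := (Nat.Primrec.const a).recursiveIn
  refine (Nat.RecursiveIn.comp (.prec ha (recursiveIn_comp_total hf hr)) h₀).of_eq fun n => ?_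
  refine (Part.bind_some _ _).trans ?_
  simp only [Nat.unpair_pair, Part.bind_eq_bind]
  induction n with
  | zero => rfl
  | succ n ih =>
    simp only at ih ⊢
    rw [ih, Part.bind_some]

end Total

/-- The function sending `k` to the code of the initial segment of length `k` is recursive in the
sequence. -/
theorem recursiveIn_initSeg (x : Cantor) :
    Nat.RecursiveIn {oracle x} fun k => Part.some (Encodable.encode (initSeg x k)) := by
  let step : ℕ → ℕ := fun q =>
    Encodable.encode (((Encodable.decode (α := List Bool) q.unpair.2).getD []) ++
      [decide (q.unpair.1 = 1)])
  have hstep : Primrec step := by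
    refine Primrec.encode.comp (Primrec.list_append.comp ?_ ?_)
    · exact Primrec.option_getD.comp (Primrec.decode.comp (Primrec.snd.comp Primrec.unpair))
        (Primrec.const [])
    · refine Primrec.list_cons.comp ?_ (Primrec.const [])
      exact (Primrec.eq.comp (Primrec.fst.comp Primrec.unpair) (Primrec.const 1)).decide
  have hstep' : Nat.RecursiveIn {oracle x} (fun q => Part.some (step q)) :=
    (Primrec.nat_iff.1 hstep).recursiveIn
  have hl : Nat.RecursiveIn {oracle x} fun n => Part.some n.unpair.1 := .left
  have hr : Nat.RecursiveIn {oracle x} fun n => Part.some n.unpair.2 := .right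
  have hx : Nat.RecursiveIn {oracle x} fun n => Part.some (x n).toNat := .oracle _ rfl
  refine (recursiveIn_natRec_total (Encodable.encode ([] : List Bool)) (recursiveIn_comp_total
    hstep' (recursiveIn_pair_total (recursiveIn_comp_total hx hl) hr))).of_eq fun k => ?_
  congr 1
  induction k with
  | zero => rfl
  | succ k ih =>
    simp only at ih ⊢
    rw [ih]
    have hb : ∀ b : Bool, decide (b.toNat = 1) = b := by decide
    simp only [step, Nat.unpair_pair, Encodable.encodek, Option.getD_some, initSeg_succ, hb]

/-- A total function whose values can be certified from initial segments of `x` in a primitive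
recursive way is computable from `x`. -/
theorem oracle_recursiveIn_of_certificate {x y : Cantor} (C : List Bool → ℕ → ℕ → Prop)
    (V : ℕ → ℕ → Bool) (hC : PrimrecPred fun a : List Bool × ℕ × ℕ => C a.1 a.2.1 a.2.2)
    (hV : Primrec₂ V) (hex : ∀ n, ∃ w, C (initSeg x w) n w)
    (hval : ∀ n w, C (initSeg x w) n w → V n w = y n) :
    RecursiveIn {oracle x} (oracle y) := by
  classical
  rw [RecursiveIn.iff_nat]
  -- `Nat.RecursiveIn.rfind` searches for a zero, so success is encoded as `0`.
  let chk : ℕ → ℕ := fun q =>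
    if C ((Encodable.decode (α := List Bool) q.unpair.1).getD []) q.unpair.2.unpair.1
      q.unpair.2.unpair.2 then 0 else 1
  have hchk : Primrec chk := by
    refine Primrec.ite ?_ (Primrec.const 0) (Primrec.const 1)
    have hu2 : Primrec fun q : ℕ => q.unpair.2.unpair :=
      Primrec.unpair.comp (Primrec.snd.comp Primrec.unpair)
    refine hC.comp (f := fun q : ℕ => ((Encodable.decode (α := List Bool) q.unpair.1).getD [],
      q.unpair.2.unpair.1, q.unpair.2.unpair.2)) ?_
    exact (Primrec.option_getD.comp (Primrec.decode.comp (Primrec.fst.comp Primrec.unpair))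
        (Primrec.const [])).pair ((Primrec.fst.comp hu2).pair (Primrec.snd.comp hu2))
  have hchk' : Nat.RecursiveIn {oracle x} (fun q => Part.some (chk q)) :=
    (Primrec.nat_iff.1 hchk).recursiveIn
  have hid : Nat.RecursiveIn {oracle x} (fun n => Part.some n) :=
    (Primrec.nat_iff.1 Primrec.id).recursiveIn
  have hr : Nat.RecursiveIn {oracle x} fun n => Part.some n.unpair.2 := .right
  -- The candidate `w` is both the witness and the length of the segment of `x` consulted, so a
  -- single unbounded search suffices.
  have hf := Nat.RecursiveIn.rfind (recursiveIn_comp_total hchk'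
    (recursiveIn_pair_total (recursiveIn_comp_total (recursiveIn_initSeg x) hr) hid))
  have hV' : Nat.RecursiveIn {oracle x}
      (fun q => Part.some (V q.unpair.1 q.unpair.2).toNat) :=
    (Primrec.nat_iff.1 ((Primrec.dom_bool Bool.toNat).comp
      (hV.comp (Primrec.fst.comp Primrec.unpair) (Primrec.snd.comp Primrec.unpair)))).recursiveIn
  refine (Nat.RecursiveIn.comp hV' (.pair hid hf)).of_eq_tot (g := fun n => (y n).toNat)
    fun n => ?_
  obtain ⟨w₀, hw₀⟩ := hex n
  obtain ⟨w, hw, -⟩ := Nat.rfind_min' (p := fun w => decide (C (initSeg x w) n w))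
    (decide_eq_true hw₀)
  have hCw : C (initSeg x w) n w := by simpa using Nat.rfind_spec hw
  refine Part.mem_bind_iff.2 ⟨Nat.pair n w, ?_, ?_⟩
  · simp only [Seq.seq, Part.map_eq_map, Part.map_some, Part.bind_some]
    refine (Part.mem_map_iff _).2 ⟨w, ?_, rfl⟩
    convert! hw using 1
    refine congrArg Nat.rfind (funext fun w' => ?_)
    by_cases h : C (initSeg x w') n w' <;> simp [chk, h]
  · simp [hval n w hCw]

/-! ### Bounded quantifiers -/

section Bounded

variable {α β : Type*} [Primcodable α] [Primcodable β]

theorem primrecPred_exists_lt {f : α → ℕ} {R : ℕ → α → Prop}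
    (hR : PrimrecPred fun b : ℕ × α => R b.1 b.2) (hf : Primrec f) :
    PrimrecPred fun a => ∃ n < f a, R n a :=
  ((PrimrecRel.exists_mem_list (R := R) hR).comp (Primrec.list_range.comp hf) Primrec.id).of_eq
    fun a => by simp

theorem primrecPred_forall_lt {f : α → ℕ} {R : ℕ → α → Prop}
    (hR : PrimrecPred fun b : ℕ × α => R b.1 b.2) (hf : Primrec f) :
    PrimrecPred fun a => ∀ n < f a, R n a :=
  ((PrimrecRel.forall_mem_list (R := R) hR).comp (Primrec.list_range.comp hf) Primrec.id).of_eq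
    fun a => by simp

theorem primrecPred_forall_mem {f : α → List β} {R : β → α → Prop}
    (hR : PrimrecPred fun b : β × α => R b.1 b.2) (hf : Primrec f) :
    PrimrecPred fun a => ∀ b ∈ f a, R b a :=
  (PrimrecRel.forall_mem_list (R := R) hR).comp hf Primrec.id

end Bounded

/-! ### Codes of uniformly effectively open sequences -/

open Nat.Partrec (Code)
open Nat.Partrec.Code (eval evaln)

theorem exists_code_eval_encode {α σ : Type*} [Primcodable α] [Primcodable σ] {g : α →. σ}
    (hg : Partrec g) :
    ∃ e : ℕ, ∀ a, eval (Denumerable.ofNat Code e) (Encodable.encode a) =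
      (g a).map Encodable.encode := by
  obtain ⟨c, hc⟩ := Nat.Partrec.Code.exists_code.1 hg
  refine ⟨Encodable.encode c, fun a => ?_⟩
  rw [Denumerable.ofNat_encode, hc]
  simp

/-- Within `π.length` steps, the machine with number `e` and the finite part `π` of the oracle
enumerates the string `ρ` into its `i`-th open set. -/
def Enumerates (e : ℕ) (π : List Bool) (i : ℕ) (ρ : List Bool) : Prop :=
  ∃ j < π.length + 1, ∃ s < π.length + 1,
    evaln π.length (Denumerable.ofNat Code e) (Encodable.encode (π.take j, i, s)) =
      some (Encodable.encode (some ρ))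

/-- The `i`-th open set enumerated by the machine with number `e` and the oracle `z`. -/
def effectiveOpen (e : ℕ) (z : Cantor) (i : ℕ) : Set Cantor :=
  {x | ∃ k ρ, Enumerates e (initSeg z k) i ρ ∧ x ∈ cylinder ρ}

theorem primrecPred_enumerates :
    PrimrecPred fun a : ℕ × List Bool × ℕ × List Bool =>
      Enumerates a.1 a.2.1 a.2.2.1 a.2.2.2 := by
  have hlen : Primrec fun a : ℕ × List Bool × ℕ × List Bool => a.2.1.length + 1 :=
    Primrec.succ.comp (Primrec.list_length.comp (Primrec.fst.comp Primrec.snd))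
  refine primrecPred_exists_lt (R := fun (j : ℕ) (a : ℕ × List Bool × ℕ × List Bool) =>
      ∃ s < a.2.1.length + 1, evaln a.2.1.length (Denumerable.ofNat Code a.1)
        (Encodable.encode (a.2.1.take j, a.2.2.1, s)) =
          some (Encodable.encode (some a.2.2.2))) ?_ hlen
  refine primrecPred_exists_lt (R := fun (s : ℕ) (b : ℕ × ℕ × List Bool × ℕ × List Bool) =>
      evaln b.2.2.1.length (Denumerable.ofNat Code b.2.1)
        (Encodable.encode (b.2.2.1.take b.1, b.2.2.2.1, s)) =
          some (Encodable.encode (some b.2.2.2.2))) ?_ (hlen.comp Primrec.snd)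
  have hπ : Primrec fun a : ℕ × ℕ × ℕ × List Bool × ℕ × List Bool => a.2.2.2.1 :=
    Primrec.fst.comp (Primrec.snd.comp (Primrec.snd.comp Primrec.snd))
  refine Primrec.eq.comp (f := fun a : ℕ × ℕ × ℕ × List Bool × ℕ × List Bool =>
      evaln a.2.2.2.1.length (Denumerable.ofNat Code a.2.2.1)
      (Encodable.encode (a.2.2.2.1.take a.2.1, a.2.2.2.2.1, a.1)))
    (g := fun a => some (Encodable.encode (some a.2.2.2.2.2))) ?_ ?_
  · refine Nat.Partrec.Code.primrec_evaln.comp (Primrec.pair (Primrec.pair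
      (Primrec.list_length.comp hπ) ((Primrec.ofNat Code).comp
        (Primrec.fst.comp (Primrec.snd.comp Primrec.snd)))) (Primrec.encode.comp
        (Primrec.pair (Primrec.list_take.comp (Primrec.fst.comp Primrec.snd) hπ)
          (Primrec.pair ?_ Primrec.fst))))
    exact Primrec.fst.comp (Primrec.snd.comp (Primrec.snd.comp
      (Primrec.snd.comp Primrec.snd)))
  · exact Primrec.option_some.comp (Primrec.encode.comp (Primrec.option_some.comp
      (Primrec.snd.comp (Primrec.snd.comp (Primrec.snd.comp
        (Primrec.snd.comp Primrec.snd))))))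

/-- The truncation `π.take j` in the definition makes this hold: the machine itself need not behave
monotonically in its string argument. -/
theorem Enumerates.mono {e : ℕ} {π π' : List Bool} {i : ℕ} {ρ : List Bool}
    (h : Enumerates e π i ρ) (hp : π <+: π') : Enumerates e π' i ρ := by
  obtain ⟨j, hj, s, hs, h⟩ := h
  have hl := hp.length_le
  refine ⟨j, by omega, s, by omega, ?_⟩
  have : π'.take j = π.take j := by
    obtain ⟨r, rfl⟩ := hp
    rw [List.take_append_of_le_length (by omega)]
  rw [this]
  exact Nat.Partrec.Code.evaln_mono hl h

theorem exists_enumerates_iff {e : ℕ} {z : Cantor} {i : ℕ} {ρ : List Bool} :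
    (∃ k, Enumerates e (initSeg z k) i ρ) ↔
      ∃ k s : ℕ, Encodable.encode (some ρ) ∈
        eval (Denumerable.ofNat Code e) (Encodable.encode (initSeg z k, i, s)) := by
  constructor
  · rintro ⟨k, j, hj, s, -, h⟩
    rw [length_initSeg] at hj
    rw [take_initSeg _ (by omega)] at h
    exact ⟨j, s, Nat.Partrec.Code.evaln_sound h⟩
  · rintro ⟨k, s, h⟩
    obtain ⟨n, hn⟩ := Nat.Partrec.Code.evaln_complete.1 h
    -- One length must bound the number of steps, the part of the oracle and the stage.
    refine ⟨max n (max k s), k, by simp, s, by simp, ?_⟩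
    rw [take_initSeg _ (by simp), length_initSeg]
    exact Nat.Partrec.Code.evaln_mono (le_max_left _ _) hn

theorem mem_effectiveOpen_iff {e : ℕ} {z x : Cantor} {i : ℕ} :
    x ∈ effectiveOpen e z i ↔ ∃ (k s : ℕ) (ρ : List Bool), Encodable.encode (some ρ) ∈
        eval (Denumerable.ofNat Code e) (Encodable.encode (initSeg z k, i, s)) ∧
      x ∈ cylinder ρ := by
  constructor
  · rintro ⟨k, ρ, h, hx⟩
    obtain ⟨k, s, h⟩ := exists_enumerates_iff.1 ⟨k, h⟩
    exact ⟨k, s, ρ, h, hx⟩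
  · rintro ⟨k, s, ρ, h, hx⟩
    obtain ⟨k, h⟩ := exists_enumerates_iff.2 ⟨k, s, h⟩
    exact ⟨k, ρ, h, hx⟩

/-- Every uniformly effectively open sequence relative to `z` has a code. -/
theorem UniformlySigma1In.exists_code {z : Cantor} {U : ℕ → Set Cantor}
    (hU : UniformlySigma1In {oracle z} U) : ∃ e, ∀ i, U i = effectiveOpen e z i := by
  obtain ⟨f, hf, hU⟩ := hU
  obtain ⟨φ, hφ, -, lφ⟩ := exists_partrec_of_recursiveIn hf
  have hg : Partrec fun a : List Bool × ℕ × ℕ => φ a.1 (Encodable.encode a.2) :=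
    hφ.comp Computable.fst (Computable.encode.comp Computable.snd)
  obtain ⟨e, he⟩ := exists_code_eval_encode hg
  refine ⟨e, fun i => ?_⟩
  ext x
  rw [hU, mem_effectiveOpen_iff]
  have key : ∀ s ρ, f i s = some ρ ↔ ∃ k, Encodable.encode (some ρ) ∈
      eval (Denumerable.ofNat Code e) (Encodable.encode (initSeg z k, i, s)) := by
    intro s ρ
    have h₁ := lφ (Encodable.encode (i, s)) (Encodable.encode (some ρ))
    simp only [Encodable.encodek, Part.coe_some, Part.bind_some, Part.map_some,
      Part.mem_some_iff, Encodable.encode_inj] at h₁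
    rw [eq_comm, h₁]
    refine exists_congr fun k => ?_
    rw [he]
    simp
  constructor
  · rintro ⟨s, ρ, h, hx⟩
    obtain ⟨k, hk⟩ := (key s ρ).1 h
    exact ⟨k, s, ρ, hk, hx⟩
  · rintro ⟨k, s, ρ, h, hx⟩
    exact ⟨s, ρ, (key s ρ).2 ⟨k, h⟩, hx⟩

/-- A computable function of finite parts of the oracle yields a code. -/
theorem exists_code_of_computable {g : List Bool × ℕ × ℕ → Option (List Bool)}
    (hg : Computable g) :
    ∃ e, ∀ z i, effectiveOpen e z i =
      {x | ∃ k s ρ, g (initSeg z k, i, s) = some ρ ∧ x ∈ cylinder ρ} := by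
  obtain ⟨e, he⟩ := exists_code_eval_encode hg.partrec
  refine ⟨e, fun z i => ?_⟩
  ext x
  rw [mem_effectiveOpen_iff]
  simp only [he, PFun.coe_val, Part.map_some, Part.mem_some_iff, Encodable.encode_inj]
  simp only [Set.mem_ofPred_eq, eq_comm]

/-! ### Strings of a given length and the measure of clopen sets -/

/-- The list of all binary strings of length `n`. -/
def strings : ℕ → List (List Bool)
  | 0 => [[]]
  | n + 1 => (strings n).map (List.cons false) ++ (strings n).map (List.cons true)

theorem mem_strings {n : ℕ} {ρ : List Bool} : ρ ∈ strings n ↔ ρ.length = n := by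
  induction n generalizing ρ with
  | zero => simp [strings]
  | succ n ih =>
    cases ρ with
    | nil => simp [strings]
    | cons b ρ => cases b <;> simp [strings, ih]

theorem length_strings (n : ℕ) : (strings n).length = 2 ^ n := by
  induction n with
  | zero => rfl
  | succ n ih => simp [strings, ih]; ring

theorem primrec_strings : Primrec strings := by
  have : Primrec fun n : ℕ => Nat.rec (motive := fun _ => List (List Bool)) [[]]
      (fun _ l => l.map (List.cons false) ++ l.map (List.cons true)) n := by
    refine Primrec.nat_rec₁ _ ?_
    exact Primrec.list_append.comp
      (Primrec.list_map Primrec.snd (Primrec.list_cons.comp (Primrec.const false) Primrec.snd))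
      (Primrec.list_map Primrec.snd (Primrec.list_cons.comp (Primrec.const true) Primrec.snd))
  refine this.of_eq fun n => ?_
  induction n with
  | zero => rfl
  | succ n ih => simp only [strings, ← ih]

theorem measurableSet_cylinder (σ : List Bool) : MeasurableSet (cylinder σ) := by
  have : cylinder σ = ⋂ (i : ℕ) (h : i < σ.length), (fun x : Cantor => x i) ⁻¹' {σ[i]} := by
    ext x; simp [cylinder]
  rw [this]
  exact MeasurableSet.iInter fun i => MeasurableSet.iInter fun h =>
    measurable_pi_apply i MeasurableSet.of_discrete

theorem measurableSet_initSeg (P : List Bool → Prop) (m : ℕ) :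
    MeasurableSet {x : Cantor | P (initSeg x m)} := by
  have : {x : Cantor | P (initSeg x m)} =
      ⋃ (σ : List Bool) (_ : P σ ∧ σ.length = m), cylinder σ := by
    ext x
    simp only [Set.mem_ofPred_eq, Set.mem_iUnion, mem_cylinder_iff, exists_prop]
    constructor
    · intro h
      exact ⟨initSeg x m, ⟨h, by simp⟩, by simp⟩
    · rintro ⟨σ, ⟨h, rfl⟩, h'⟩
      rwa [h']
  rw [this]
  exact MeasurableSet.iUnion fun σ => MeasurableSet.iUnion fun _ => measurableSet_cylinder σ

theorem mem_cylinder_concat (x : Cantor) (τ : List Bool) (b : Bool) :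
    x ∈ cylinder (τ ++ [b]) ↔ x ∈ cylinder τ ∧ x τ.length = b := by
  rw [mem_cylinder_iff, mem_cylinder_iff, List.length_append, List.length_singleton, initSeg_succ]
  constructor
  · intro h
    have := List.append_inj' h rfl
    simpa using this
  · rintro ⟨h₁, h₂⟩
    rw [h₁, h₂]

open Classical in
/-- The measure of a clopen subset of a cylinder as a sum over strings. -/
theorem measureReal_cylinder_inter (μ : Measure Cantor) [IsFiniteMeasure μ]
    (P : List Bool → Prop) (n : ℕ) (τ : List Bool) :
    μ.real {x | x ∈ cylinder τ ∧ P (initSeg x (τ.length + n))} =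
      ((strings n).map fun ρ => if P (τ ++ ρ) then μ.real (cylinder (τ ++ ρ)) else 0).sum := by
  induction n generalizing τ with
  | zero =>
    have : {x | x ∈ cylinder τ ∧ P (initSeg x (τ.length + 0))} =
        {x | x ∈ cylinder τ ∧ P τ} := by
      ext x
      refine and_congr_right fun h => ?_
      rw [add_zero, (mem_cylinder_iff x τ).1 h]
    rw [this]
    by_cases h : P τ <;> simp [strings, h]
  | succ n ih =>
    have ht : MeasurableSet {x : Cantor | x τ.length = true} :=
      (measurable_pi_apply τ.length : Measurable fun x : Cantor => x τ.length)
        (MeasurableSet.of_discrete (s := {true}))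
    rw [← measureReal_inter_add_sdiff ht, strings, List.map_append, List.sum_append, add_comm]
    congr 1
    · rw [List.map_map]
      have h := ih (τ ++ [false])
      simp only [List.append_assoc, List.singleton_append] at h
      refine Eq.trans ?_ h
      congr 1
      ext x
      simp only [Set.mem_sdiff, Set.mem_ofPred_eq, mem_cylinder_concat, List.length_append,
        List.length_singleton, Bool.not_eq_true, add_assoc, add_comm 1 n]
      tauto
    · rw [List.map_map]
      have h := ih (τ ++ [true])
      simp only [List.append_assoc, List.singleton_append] at h
      refine Eq.trans ?_ h
      congr 1
      ext x
      simp only [Set.mem_inter_iff, Set.mem_ofPred_eq, mem_cylinder_concat, List.length_append,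
        List.length_singleton, add_assoc, add_comm 1 n]
      tauto

instance (p : unitInterval) : IsProbabilityMeasure (bernoulli p) := by
  unfold bernoulli; infer_instance

theorem bernoulli_real_cylinder (p : unitInterval) (σ : List Bool) :
    (bernoulli p).real (cylinder σ) =
      (p : ℝ) ^ σ.count false * (1 - (p : ℝ)) ^ σ.count true := by
  rw [Measure.real, bernoulli_cylinder, ENNReal.toReal_ofReal]
  have := sub_nonneg.2 p.2.2
  have := p.2.1
  positivity

theorem count_false_add_count_true (σ : List Bool) :
    σ.count false + σ.count true = σ.length := by
  induction σ with
  | nil => rfl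
  | cons b σ ih => cases b <;> simp <;> omega

/-! ### Dyadic approximations read off from the binary expansion -/

/-- The natural number with the given binary digits, the most significant one first. -/
def binaryValue (π : List Bool) : ℕ := π.foldl (fun a b => 2 * a + b.toNat) 0

theorem binaryValue_concat (π : List Bool) (b : Bool) :
    binaryValue (π ++ [b]) = 2 * binaryValue π + b.toNat := by
  simp [binaryValue]

theorem binaryValue_injective {π π' : List Bool} (hl : π.length = π'.length)
    (h : binaryValue π = binaryValue π') : π = π' := by
  induction π using List.reverseRecOn generalizing π' with
  | nil => exact (List.eq_nil_of_length_eq_zero hl.symm).symm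
  | append_singleton π b ih =>
    rcases List.eq_nil_or_concat π' with rfl | ⟨π', b', rfl⟩
    · simp at hl
    · rw [List.concat_eq_append] at *
      simp only [List.length_append, List.length_singleton, Nat.add_right_cancel_iff] at hl
      rw [binaryValue_concat, binaryValue_concat] at h
      have : binaryValue π = binaryValue π' ∧ b = b' := by
        cases b <;> cases b' <;> simp at h ⊢ <;> omega
      rw [ih hl this.1, this.2]

theorem primrec_binaryValue : Primrec binaryValue := by
  refine Primrec.list_foldl (h := fun (_ : List Bool) (s : ℕ × Bool) => 2 * s.1 + s.2.toNat)
    Primrec.id (Primrec.const 0) ?_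
  exact Primrec.nat_add.comp (Primrec.nat_mul.comp (Primrec.const 2)
    (Primrec.fst.comp Primrec.snd)) ((Primrec.dom_bool _).comp (Primrec.snd.comp Primrec.snd))

/-- Halving `⌊p * 2 ^ (t + 1)⌋` leaves the quotient `⌊p * 2 ^ t⌋` and, as remainder, the digit
number `t`. The induction starts from `⌊p⌋ = 0`, which is where `p < 1` enters. -/
theorem binaryValue_initSeg {p : unitInterval} (hp : p < 1) (t : ℕ) :
    binaryValue (initSeg (binaryExpansion p) t) = ⌊(p : ℝ) * 2 ^ t⌋₊ := by
  have hp₁ : (p : ℝ) < 1 := hp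
  have hp₀ : (0 : ℝ) ≤ p := p.2.1
  induction t with
  | zero => simp [initSeg, binaryValue, Nat.floor_eq_zero.2 hp₁]
  | succ t ih =>
    rw [initSeg_succ, binaryValue_concat, ih]
    have hb : (binaryExpansion p t).toNat = ⌊(p : ℝ) * 2 ^ (t + 1)⌋₊ % 2 := by
      simp only [binaryExpansion, Real.digits]
      rcases Nat.mod_two_eq_zero_or_one ⌊(p : ℝ) * 2 ^ (t + 1)⌋₊ with h | h
      · simp [Fin.ext_iff, h]
      · simp [Fin.ext_iff, h]
    have hd : ⌊(p : ℝ) * 2 ^ t⌋₊ = ⌊(p : ℝ) * 2 ^ (t + 1)⌋₊ / 2 := by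
      have := Nat.floor_div_natCast ((p : ℝ) * 2 ^ (t + 1)) 2
      rw [← this]
      congr 1
      push_cast
      rw [pow_succ]; ring
    rw [hb, hd]
    omega

theorem binaryValue_initSeg_le {p : unitInterval} (hp : p < 1) (t : ℕ) :
    (binaryValue (initSeg (binaryExpansion p) t) : ℝ) ≤ p * 2 ^ t := by
  rw [binaryValue_initSeg hp]
  exact Nat.floor_le (mul_nonneg p.2.1 (by positivity))

theorem lt_binaryValue_initSeg {p : unitInterval} (hp : p < 1) (t : ℕ) :
    p * 2 ^ t < (binaryValue (initSeg (binaryExpansion p) t) : ℝ) + 1 := by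
  rw [binaryValue_initSeg hp]
  exact Nat.lt_floor_add_one _

/-- An upper approximation to `2 ^ (π.length * σ.length) * μ_p(⟦σ⟧)`, where `π` is an initial
segment of the binary expansion of `p`. -/
def weight (π σ : List Bool) : ℕ :=
  (binaryValue π + 1) ^ σ.count false * (2 ^ π.length - binaryValue π) ^ σ.count true

theorem primrec_pow : Primrec₂ ((· ^ ·) : ℕ → ℕ → ℕ) := Primrec₂.unpaired'.1 Nat.Primrec.pow

theorem primrec_count (b : Bool) : Primrec fun σ : List Bool => σ.count b := by
  have h : PrimrecPred fun c : Bool => c = b := Primrec.eq.comp Primrec.id (Primrec.const b)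
  refine (Primrec.list_length.comp (Primrec.listFilter h)).of_eq fun σ => ?_
  rw [List.count_eq_length_filter]
  congr 2

theorem primrec_weight : Primrec₂ weight := by
  refine Primrec.nat_mul.comp (primrec_pow.comp ?_ ((primrec_count _).comp Primrec.snd))
    (primrec_pow.comp ?_ ((primrec_count _).comp Primrec.snd))
  · exact Primrec.succ.comp (primrec_binaryValue.comp Primrec.fst)
  · exact Primrec.nat_sub.comp (primrec_pow.comp (Primrec.const 2)
      (Primrec.list_length.comp Primrec.fst)) (primrec_binaryValue.comp Primrec.fst)

theorem cast_weight_initSeg {p : unitInterval} (hp : p < 1) (t : ℕ) (σ : List Bool) :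
    (weight (initSeg (binaryExpansion p) t) σ : ℝ) =
      ((binaryValue (initSeg (binaryExpansion p) t) : ℝ) + 1) ^ σ.count false *
        (2 ^ t - binaryValue (initSeg (binaryExpansion p) t)) ^ σ.count true := by
  -- This keeps the natural subtraction in `weight` from being truncated.
  have h : binaryValue (initSeg (binaryExpansion p) t) ≤ 2 ^ t := by
    have h₁ := binaryValue_initSeg_le hp t
    have h₂ : (p : ℝ) * 2 ^ t ≤ 2 ^ t := mul_le_of_le_one_left (by positivity) p.2.2
    exact_mod_cast h₁.trans h₂
  rw [weight, length_initSeg]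
  push_cast [Nat.cast_sub h]
  rfl

/-- With `a` the value of the first `t` digits, `a ≤ p * 2 ^ t < a + 1`; hence `a + 1` and `2 ^ t -
a` bound the scaled probabilities of the two bits from above. -/
theorem real_cylinder_le_weight {p : unitInterval} (hp : p < 1) (t : ℕ) (σ : List Bool) :
    2 ^ (t * σ.length) * (bernoulli p).real (cylinder σ) ≤
      weight (initSeg (binaryExpansion p) t) σ := by
  rw [cast_weight_initSeg hp, bernoulli_real_cylinder, ← count_false_add_count_true σ, mul_add,
    pow_add, pow_mul, pow_mul, mul_mul_mul_comm, ← mul_pow, ← mul_pow]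
  have h₁ := binaryValue_initSeg_le hp t
  have h₂ := lt_binaryValue_initSeg hp t
  have hp₀ : (0 : ℝ) ≤ p := p.2.1
  have hp₁ := sub_nonneg.2 p.2.2
  gcongr
  · linarith
  · linarith

/-- Rounding adds at most `1` to the scaled probability of a bit, and `1` is at most `N` times
either unscaled probability. So each bit costs a factor of at most `1 + N / 2 ^ t`. -/
theorem weight_le_real_cylinder {p : unitInterval} (hp : p < 1) {N : ℕ}
    (hN₀ : 1 ≤ N * (p : ℝ)) (hN₁ : 1 ≤ N * (1 - (p : ℝ))) (t : ℕ) (σ : List Bool) :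
    (weight (initSeg (binaryExpansion p) t) σ : ℝ) ≤
      (1 + N / 2 ^ t) ^ σ.length * (2 ^ (t * σ.length) * (bernoulli p).real (cylinder σ)) := by
  have e : (1 + (N : ℝ) / 2 ^ t) ^ σ.length * (2 ^ (t * σ.length) *
      (bernoulli p).real (cylinder σ)) =
        ((1 + (N : ℝ) / 2 ^ t) * (2 ^ t * p)) ^ σ.count false *
          ((1 + (N : ℝ) / 2 ^ t) * (2 ^ t * (1 - p))) ^ σ.count true := by
    rw [bernoulli_real_cylinder, ← count_false_add_count_true σ, pow_mul, mul_pow, mul_pow,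
      mul_pow, mul_pow, pow_add, pow_add]
    ring
  rw [e, cast_weight_initSeg hp]
  have h₁ := binaryValue_initSeg_le hp t
  have h₂ := lt_binaryValue_initSeg hp t
  have hp₀ : (0 : ℝ) ≤ p := p.2.1
  have hp₁ := sub_nonneg.2 p.2.2
  have h2 : (0 : ℝ) < 2 ^ t := by positivity
  have e₀ : (1 + (N : ℝ) / 2 ^ t) * (2 ^ t * p) = p * 2 ^ t + N * p := by field_simp
  have e₁ : (1 + (N : ℝ) / 2 ^ t) * (2 ^ t * (1 - p)) = (1 - p) * 2 ^ t + N * (1 - p) := by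
    field_simp
  rw [e₀, e₁]
  have h₃ : (p : ℝ) * 2 ^ t ≤ 2 ^ t := mul_le_of_le_one_left (by positivity) p.2.2
  have h₄ : (0 : ℝ) ≤ 2 ^ t - binaryValue (initSeg (binaryExpansion p) t) := by linarith
  refine mul_le_mul (pow_le_pow_left₀ (by positivity) (by linarith) _)
    (pow_le_pow_left₀ h₄ (by linarith) _) (pow_nonneg h₄ _) (by positivity)

/-! ### The open set forbidden by a history and its complement in a cylinder -/

/-- The exponent bounding from below the measure that is kept at stage `n`. -/
def stageExponent (K n : ℕ) : ℕ := 2 * K ^ (n + 1)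

theorem primrec_stageExponent (K : ℕ) : Primrec (stageExponent K) :=
  Primrec.nat_mul.comp (Primrec.const 2)
    (primrec_pow.comp (Primrec.const K) Primrec.succ)

/-- The string `ρ` is seen, with the finite part `π` of the oracle, to lie in the open set
forbidden by the history `h`. -/
def Covered (K : ℕ) (h π ρ : List Bool) : Prop :=
  ∃ e < h.length, h.getD (2 * e) false = true ∧ ∃ j < ρ.length + 1,
    Enumerates e π (stageExponent K (2 * e + 1)) (ρ.take j)

/-- The open set forbidden by the history `h`: the bit of `h` at position `2 * e` says whether the
`e`-th effectively open sequence is to be avoided. -/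
def forbidden (K : ℕ) (z : Cantor) (h : List Bool) : Set Cantor :=
  {x | ∃ e, h.getD (2 * e) false = true ∧ x ∈ effectiveOpen e z (stageExponent K (2 * e + 1))}

theorem primrecPred_covered (K : ℕ) :
    PrimrecPred fun a : List Bool × List Bool × List Bool => Covered K a.1 a.2.1 a.2.2 := by
  refine primrecPred_exists_lt (R := fun (e : ℕ) (a : List Bool × List Bool × List Bool) =>
    a.1.getD (2 * e) false = true ∧ ∃ j < a.2.2.length + 1,
      Enumerates e a.2.1 (stageExponent K (2 * e + 1)) (a.2.2.take j)) (PrimrecPred.and ?_ ?_)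
      (Primrec.list_length.comp Primrec.fst)
  · exact Primrec.eq.comp ((Primrec.list_getD false).comp (Primrec.fst.comp Primrec.snd)
      (Primrec.nat_double.comp Primrec.fst)) (Primrec.const true)
  · refine primrecPred_exists_lt
      (R := fun (j : ℕ) (b : ℕ × List Bool × List Bool × List Bool) =>
        Enumerates b.1 b.2.2.1 (stageExponent K (2 * b.1 + 1)) (b.2.2.2.take j)) ?_
      (Primrec.succ.comp (Primrec.list_length.comp
        (Primrec.snd.comp (Primrec.snd.comp Primrec.snd))))
    refine primrecPred_enumerates.comp
      (f := fun b : ℕ × ℕ × List Bool × List Bool × List Bool =>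
        (b.2.1, b.2.2.2.1, stageExponent K (2 * b.2.1 + 1), b.2.2.2.2.take b.1)) ?_
    have he : Primrec fun b : ℕ × ℕ × List Bool × List Bool × List Bool => b.2.1 :=
      Primrec.fst.comp Primrec.snd
    have hr : Primrec fun b : ℕ × ℕ × List Bool × List Bool × List Bool => b.2.2.2 :=
      Primrec.snd.comp (Primrec.snd.comp Primrec.snd)
    exact he.pair ((Primrec.fst.comp hr).pair (((primrec_stageExponent K).comp
      (Primrec.nat_double_succ.comp he)).pair
        (Primrec.list_take.comp Primrec.fst (Primrec.snd.comp hr))))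

theorem Covered.mono {K : ℕ} {h π π' ρ ρ' : List Bool} (hc : Covered K h π ρ)
    (hπ : π <+: π') (hρ : ρ <+: ρ') : Covered K h π' ρ' := by
  obtain ⟨e, he, hb, j, hj, hc⟩ := hc
  have hl := hρ.length_le
  refine ⟨e, he, hb, j, by omega, ?_⟩
  obtain ⟨r, rfl⟩ := hρ
  rw [List.take_append_of_le_length (by omega)]
  exact hc.mono hπ

theorem mem_forbidden_iff {K : ℕ} {z : Cantor} {h : List Bool} {x : Cantor} :
    x ∈ forbidden K z h ↔ ∃ k m, Covered K h (initSeg z k) (initSeg x m) := by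
  constructor
  · rintro ⟨e, hb, k, ρ, hE, hx⟩
    have he : e < h.length := by
      by_contra hlt
      rw [List.getD_eq_default _ _ (by omega)] at hb
      exact absurd hb (by simp)
    refine ⟨k, ρ.length, e, he, hb, ρ.length, by simp, ?_⟩
    rwa [(mem_cylinder_iff x ρ).1 hx, List.take_length]
  · rintro ⟨k, m, e, -, hb, j, hj, hE⟩
    rw [length_initSeg] at hj
    rw [take_initSeg _ (by omega)] at hE
    exact ⟨e, hb, k, _, hE, by simp [mem_cylinder_iff]⟩

/-! ### Upper approximations to the measure left over, and dead strings -/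

open Classical in
/-- An upper approximation to the measure of the part of the cylinder of `τ` that is not
forbidden, scaled by a power of two. -/
noncomputable def survivingWeight (K : ℕ) (π h τ : List Bool) : ℕ :=
  ((strings (π.length - τ.length)).map fun ρ =>
    if Covered K h π (τ ++ ρ) then 0 else weight π (τ ++ ρ)).sum

theorem primrec_list_sum : Primrec (List.sum : List ℕ → ℕ) :=
  Primrec.list_foldr (h := fun (_ : List ℕ) (b : ℕ × ℕ) => b.1 + b.2) Primrec.id
    (Primrec.const 0) (Primrec.nat_add.comp (Primrec.fst.comp Primrec.snd)
      (Primrec.snd.comp Primrec.snd))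

theorem primrec_survivingWeight (K : ℕ) :
    Primrec fun a : List Bool × List Bool × List Bool => survivingWeight K a.1 a.2.1 a.2.2 := by
  classical
  have hτ : Primrec fun a : List Bool × List Bool × List Bool => a.2.2 :=
    Primrec.snd.comp Primrec.snd
  refine primrec_list_sum.comp (Primrec.list_map
    (primrec_strings.comp (Primrec.nat_sub.comp (Primrec.list_length.comp Primrec.fst)
      (Primrec.list_length.comp hτ))) (Primrec.ite ?_ (Primrec.const 0) ?_))
  · exact (primrecPred_covered K).comp
      (f := fun b : (List Bool × List Bool × List Bool) × List Bool =>
        (b.1.2.1, b.1.1, b.1.2.2 ++ b.2))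
      ((Primrec.fst.comp (Primrec.snd.comp Primrec.fst)).pair
        ((Primrec.fst.comp Primrec.fst).pair
          (Primrec.list_append.comp (hτ.comp Primrec.fst) Primrec.snd)))
  · exact primrec_weight.comp (Primrec.fst.comp Primrec.fst)
      (Primrec.list_append.comp (hτ.comp Primrec.fst) Primrec.snd)

/-- The oracle part `π` shows that little of the cylinder of `τ` escapes the open set forbidden by
the history `h`. -/
def Small (K : ℕ) (π h τ : List Bool) : Prop :=
  survivingWeight K π h τ * 2 ^ stageExponent K (h.length + 1) <
    4 * 2 ^ (π.length * (τ.length + (π.length - τ.length)))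

/-- Some initial part of `π` shows that the string `τ` is small. -/
def Dead (K : ℕ) (π h τ : List Bool) : Prop :=
  ∃ t < π.length + 1, Small K (π.take t) h τ

theorem primrecPred_small (K : ℕ) :
    PrimrecPred fun a : List Bool × List Bool × List Bool => Small K a.1 a.2.1 a.2.2 := by
  have hπ : Primrec fun a : List Bool × List Bool × List Bool => a.1.length :=
    Primrec.list_length.comp Primrec.fst
  have hh : Primrec fun a : List Bool × List Bool × List Bool => a.2.1.length :=
    Primrec.list_length.comp (Primrec.fst.comp Primrec.snd)
  have hτ : Primrec fun a : List Bool × List Bool × List Bool => a.2.2.length :=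
    Primrec.list_length.comp (Primrec.snd.comp Primrec.snd)
  refine Primrec.nat_lt.comp (Primrec.nat_mul.comp (primrec_survivingWeight K)
    (primrec_pow.comp (Primrec.const 2) ((primrec_stageExponent K).comp (Primrec.succ.comp hh))))
    (Primrec.nat_mul.comp (Primrec.const 4) (primrec_pow.comp (Primrec.const 2) ?_))
  exact Primrec.nat_mul.comp hπ (Primrec.nat_add.comp hτ (Primrec.nat_sub.comp hπ hτ))

theorem primrecPred_dead (K : ℕ) :
    PrimrecPred fun a : List Bool × List Bool × List Bool => Dead K a.1 a.2.1 a.2.2 := by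
  refine primrecPred_exists_lt (R := fun (t : ℕ) (a : List Bool × List Bool × List Bool) =>
    Small K (a.1.take t) a.2.1 a.2.2) ?_
      (Primrec.succ.comp (Primrec.list_length.comp Primrec.fst))
  exact (primrecPred_small K).comp
    (f := fun b : ℕ × List Bool × List Bool × List Bool => (b.2.1.take b.1, b.2.2.1, b.2.2.2))
    ((Primrec.list_take.comp Primrec.fst (Primrec.fst.comp Primrec.snd)).pair
      (Primrec.snd.comp Primrec.snd))

/-- As for `Enumerates`, the quantifier over truncations builds the monotonicity into the
definition. -/
theorem Dead.mono {K : ℕ} {π π' h τ : List Bool} (hd : Dead K π h τ) (hp : π <+: π') :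
    Dead K π' h τ := by
  obtain ⟨t, ht, hs⟩ := hd
  have hl := hp.length_le
  refine ⟨t, by omega, ?_⟩
  obtain ⟨r, rfl⟩ := hp
  rwa [List.take_append_of_le_length (by omega)]

open Classical in
theorem survivingWeight_ge {p : unitInterval} (hp : p < 1) (K t : ℕ) (h τ : List Bool) :
    2 ^ (t * (τ.length + (t - τ.length))) * (bernoulli p).real
      {x | x ∈ cylinder τ ∧ ¬ Covered K h (initSeg (binaryExpansion p) t)
        (initSeg x (τ.length + (t - τ.length)))} ≤
      survivingWeight K (initSeg (binaryExpansion p) t) h τ := by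
  rw [measureReal_cylinder_inter (bernoulli p)
    (fun ρ => ¬ Covered K h (initSeg (binaryExpansion p) t) ρ), survivingWeight,
    length_initSeg, Nat.cast_list_sum, List.map_map, ← List.sum_map_mul_left]
  refine List.sum_le_sum fun ρ hρ => ?_
  -- The sum is `max t τ.length`: `t` may be smaller than the length of `τ`, and then only the empty
  -- extension is considered.
  have hl : τ.length + (t - τ.length) = (τ ++ ρ).length := by
    rw [List.length_append, mem_strings.1 hρ]
  by_cases hc : Covered K h (initSeg (binaryExpansion p) t) (τ ++ ρ)
  · simp [hc]
  · simp only [hc, not_false_iff, if_true, if_false, Function.comp_apply]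
    rw [hl]
    exact real_cylinder_le_weight hp t _

open Classical in
theorem survivingWeight_le {p : unitInterval} (hp : p < 1) {N : ℕ}
    (hN₀ : 1 ≤ N * (p : ℝ)) (hN₁ : 1 ≤ N * (1 - (p : ℝ))) (K t : ℕ) (h τ : List Bool) :
    (survivingWeight K (initSeg (binaryExpansion p) t) h τ : ℝ) ≤
      (1 + N / 2 ^ t) ^ (τ.length + (t - τ.length)) *
        (2 ^ (t * (τ.length + (t - τ.length))) * (bernoulli p).real
          {x | x ∈ cylinder τ ∧ ¬ Covered K h (initSeg (binaryExpansion p) t)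
            (initSeg x (τ.length + (t - τ.length)))}) := by
  rw [measureReal_cylinder_inter (bernoulli p)
    (fun ρ => ¬ Covered K h (initSeg (binaryExpansion p) t) ρ), survivingWeight,
    length_initSeg, Nat.cast_list_sum, List.map_map, ← List.sum_map_mul_left,
    ← List.sum_map_mul_left]
  refine List.sum_le_sum fun ρ hρ => ?_
  have hl : τ.length + (t - τ.length) = (τ ++ ρ).length := by
    rw [List.length_append, mem_strings.1 hρ]
  by_cases hc : Covered K h (initSeg (binaryExpansion p) t) (τ ++ ρ)
  · simp [hc]
  · simp only [hc, not_false_iff, if_true, if_false, Function.comp_apply]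
    rw [hl]
    exact weight_le_real_cylinder hp hN₀ hN₁ t _

/-- The surviving weight overestimates the measure left, since both the weights and the uncovered
clopen set err upwards. -/
theorem Dead.measure_lt {p : unitInterval} (hp : p < 1) {K k : ℕ} {h τ : List Bool}
    (hd : Dead K (initSeg (binaryExpansion p) k) h τ) :
    (bernoulli p).real (cylinder τ \ forbidden K (binaryExpansion p) h) *
      2 ^ stageExponent K (h.length + 1) < 4 := by
  obtain ⟨t, ht, hs⟩ := hd
  rw [length_initSeg] at ht
  rw [take_initSeg _ (by omega), Small, length_initSeg] at hs
  have hs' : (survivingWeight K (initSeg (binaryExpansion p) t) h τ : ℝ) *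
      2 ^ stageExponent K (h.length + 1) < 4 * 2 ^ (t * (τ.length + (t - τ.length))) := by
    exact_mod_cast hs
  have hle := survivingWeight_ge hp K t h τ
  have hsub : cylinder τ \ forbidden K (binaryExpansion p) h ⊆
      {x | x ∈ cylinder τ ∧ ¬ Covered K h (initSeg (binaryExpansion p) t)
        (initSeg x (τ.length + (t - τ.length)))} := by
    rintro x ⟨hx, hn⟩
    exact ⟨hx, fun hc => hn (mem_forbidden_iff.2 ⟨_, _, hc⟩)⟩
  have hm := measureReal_mono (μ := bernoulli p) hsub
  have h2 : (0 : ℝ) < 2 ^ (t * (τ.length + (t - τ.length))) := by positivity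
  refine lt_of_mul_lt_mul_left ?_ h2.le
  refine lt_of_le_of_lt ?_ (hs'.trans_eq (mul_comm _ _))
  rw [← mul_assoc]
  gcongr
  exact (mul_le_mul_of_nonneg_left hm h2.le).trans hle

/-- The uncovered clopen sets decrease to the part of the cylinder that is not forbidden, and the
rounding error in the weights is eventually at most a factor `2`. This factor turns the threshold
`4` of `Small` into `2`. -/
theorem le_measure_of_forall_not_dead {p : unitInterval} (hp : p < 1) {N : ℕ}
    (hN₀ : 1 ≤ N * (p : ℝ)) (hN₁ : 1 ≤ N * (1 - (p : ℝ))) {K : ℕ} {h τ : List Bool}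
    (hd : ∀ k, ¬ Dead K (initSeg (binaryExpansion p) k) h τ) :
    2 ≤ (bernoulli p).real (cylinder τ \ forbidden K (binaryExpansion p) h) *
      2 ^ stageExponent K (h.length + 1) := by
  set B := stageExponent K (h.length + 1)
  set A : ℕ → Set Cantor := fun t => {x | x ∈ cylinder τ ∧
    ¬ Covered K h (initSeg (binaryExpansion p) t) (initSeg x (τ.length + (t - τ.length)))}
    with hA
  have hanti : Antitone A := by
    intro s t hst x hx
    refine ⟨hx.1, fun hc => hx.2 (hc.mono (initSeg_prefix _ hst) (initSeg_prefix _ ?_))⟩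
    omega
  have hinter : ⋂ t, A t = cylinder τ \ forbidden K (binaryExpansion p) h := by
    ext x
    simp only [Set.mem_iInter, Set.mem_sdiff, hA, Set.mem_ofPred_eq, forall_and,
      forall_const, mem_forbidden_iff, not_exists]
    refine and_congr_right fun _ => ⟨fun hx k m hc => ?_, fun hx t => hx _ _⟩
    exact hx (max k m) (hc.mono (initSeg_prefix _ (le_max_left _ _))
      (initSeg_prefix _ (by omega)))
  have hmeas : ∀ t, MeasurableSet (A t) := fun t =>
    (measurableSet_cylinder τ).inter (measurableSet_initSeg
      (fun ρ => ¬ Covered K h (initSeg (binaryExpansion p) t) ρ) _)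
  have hlim : Filter.Tendsto (fun t => (bernoulli p).real (A t)) Filter.atTop
      (nhds ((bernoulli p).real (cylinder τ \ forbidden K (binaryExpansion p) h))) := by
    rw [← hinter]
    refine (ENNReal.tendsto_toReal (measure_ne_top _ _)).comp
      (tendsto_measure_iInter_atTop (fun t => (hmeas t).nullMeasurableSet) hanti
        ⟨0, measure_ne_top _ _⟩)
  -- The rounding factor is `(1 + N / 2 ^ t) ^ t ≤ exp (t * (N / 2 ^ t))`; it is at most `2` once
  -- this exponent is below `log 2`.
  have hexp : Filter.Tendsto (fun t : ℕ => (t : ℝ) * (N / 2 ^ t)) Filter.atTop (nhds 0) := by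
    have := tendsto_pow_const_mul_const_pow_of_abs_lt_one 1 (r := (2 : ℝ)⁻¹)
      (by rw [abs_of_pos] <;> norm_num)
    have := this.mul_const (N : ℝ)
    rw [zero_mul] at this
    refine this.congr fun t => ?_
    rw [inv_pow]; ring
  refine ge_of_tendsto (hlim.mul_const _) ?_
  filter_upwards [Filter.eventually_ge_atTop τ.length,
    hexp.eventually_le_const (Real.log_pos one_lt_two)] with t hτ ht
  have hm : τ.length + (t - τ.length) = t := by omega
  have hle := survivingWeight_le hp hN₀ hN₁ K t h τ
  have hpow : (1 + (N : ℝ) / 2 ^ t) ^ (τ.length + (t - τ.length)) ≤ 2 := by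
    rw [hm]
    calc (1 + (N : ℝ) / 2 ^ t) ^ t ≤ Real.exp (N / 2 ^ t) ^ t := by
          gcongr; rw [add_comm]; exact Real.add_one_le_exp _
      _ = Real.exp (t * (N / 2 ^ t)) := by rw [← Real.exp_nat_mul]
      _ ≤ 2 := by rwa [← Real.le_log_iff_exp_le two_pos]
  have hns : ¬ Small K (initSeg (binaryExpansion p) t) h τ := fun hs =>
    hd t ⟨t, by simp, by rwa [take_initSeg _ le_rfl]⟩
  rw [Small, length_initSeg, not_lt] at hns
  have hns' : (4 : ℝ) * 2 ^ (t * (τ.length + (t - τ.length))) ≤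
      survivingWeight K (initSeg (binaryExpansion p) t) h τ * 2 ^ B := by
    exact_mod_cast hns
  have h2 : (0 : ℝ) < 2 ^ (t * (τ.length + (t - τ.length))) := by positivity
  have hle' := hle.trans (mul_le_mul_of_nonneg_right hpow
    (mul_nonneg h2.le measureReal_nonneg))
  have hfin := hns'.trans (mul_le_mul_of_nonneg_right hle' (by positivity : (0 : ℝ) ≤ 2 ^ B))
  refine le_of_mul_le_mul_left ?_ (mul_pos two_pos h2)
  calc _ = (4 : ℝ) * 2 ^ (t * (τ.length + (t - τ.length))) := by ring
    _ ≤ _ := hfin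
    _ = _ := by ring

/-! ### Coding one bit -/

/-- The codes of the `μ_p`-Martin-Löf tests relative to `p`. -/
def testCodes (p : unitInterval) : Set ℕ :=
  {e | ∀ i, bernoulli p (effectiveOpen e (binaryExpansion p) i) ≤ (2⁻¹ : ℝ≥0∞) ^ i}

/-- The string `σ` is a suitable position of the construction after the history `h`. -/
def Position (p : unitInterval) (K : ℕ) (h σ : List Bool) : Prop :=
  σ.length = K ^ (h.length + 1) ∧
    1 ≤ (bernoulli p).real (cylinder σ \ forbidden K (binaryExpansion p) h) *
      2 ^ stageExponent K h.length

/-- The oracle part `π` shows that the position `τ`, reached at the stage after the history `h`,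
codes the bit `b`: all competitors with a smaller code (for `b = false`), or all those with a
larger code (for `b = true`), are dead. -/
def Decodes (K : ℕ) (π h τ : List Bool) (b : Bool) : Prop :=
  ∀ ρ ∈ strings (K ^ (h.length + 2) - K ^ (h.length + 1)),
    (if b = true then
      Encodable.encode τ < Encodable.encode (τ.take (K ^ (h.length + 1)) ++ ρ)
    else Encodable.encode (τ.take (K ^ (h.length + 1)) ++ ρ) < Encodable.encode τ) →
      Dead K π h (τ.take (K ^ (h.length + 1)) ++ ρ)

theorem Decodes.mono {K : ℕ} {π π' h τ : List Bool} {b : Bool} (hd : Decodes K π h τ b)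
    (hp : π <+: π') : Decodes K π' h τ b :=
  fun ρ hρ hlt => (hd ρ hρ hlt).mono hp

theorem forbidden_nil (K : ℕ) (z : Cantor) : forbidden K z [] = ∅ := by
  ext x; simp [forbidden]

/-- Nothing is forbidden yet, and the more likely bit has probability at least `1/2`, so repeating
it `K` times leaves measure at least `2 ^ (-K)`. -/
theorem exists_position_nil (p : unitInterval) (K : ℕ) : ∃ σ, Position p K [] σ := by
  have hp₀ : (0 : ℝ) ≤ p := p.2.1
  have hp₁ : (0 : ℝ) ≤ 1 - p := sub_nonneg.2 p.2.2
  have key : ∃ b, (2⁻¹ : ℝ) ^ K ≤ (bernoulli p).real (cylinder (List.replicate K b)) := by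
    rcases le_total (2⁻¹ : ℝ) p with h | h
    · refine ⟨false, ?_⟩
      rw [bernoulli_real_cylinder]
      simpa [List.count_replicate] using pow_le_pow_left₀ (by norm_num) h K
    · refine ⟨true, ?_⟩
      rw [bernoulli_real_cylinder]
      have h' : (2⁻¹ : ℝ) ≤ 1 - p := by
        have : (2⁻¹ : ℝ) = 1 - 2⁻¹ := by norm_num
        linarith
      simpa [List.count_replicate] using pow_le_pow_left₀ (by norm_num) h' K
  obtain ⟨b, hb⟩ := key
  refine ⟨List.replicate K b, by simp, ?_⟩
  rw [forbidden_nil, Set.sdiff_empty]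
  have h2 : (1 : ℝ) = 2⁻¹ ^ K * 2 ^ K := by rw [← mul_pow]; norm_num
  have hK : (2 : ℝ) ^ K ≤ 2 ^ stageExponent K ([] : List Bool).length := by
    refine pow_le_pow_right₀ one_le_two ?_
    simp [stageExponent]; omega
  calc (1 : ℝ) = 2⁻¹ ^ K * 2 ^ K := h2
    _ ≤ _ := mul_le_mul hb hK (by positivity) measureReal_nonneg

theorem forbidden_concat_subset (K : ℕ) (z : Cantor) (h : List Bool) (b : Bool) :
    forbidden K z (h ++ [b]) ⊆ forbidden K z h ∪
      {x | ∃ e, h.length = 2 * e ∧ b = true ∧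
        x ∈ effectiveOpen e z (stageExponent K (2 * e + 1))} := by
  rintro x ⟨e, hb, hx⟩
  rcases lt_trichotomy (2 * e) h.length with hlt | heq | hgt
  · rw [List.getD_append _ _ _ _ hlt] at hb
    exact Or.inl ⟨e, hb, hx⟩
  · right
    refine ⟨e, heq.symm, ?_, hx⟩
    rw [List.getD_append_right _ _ _ _ heq.ge, heq] at hb
    simpa using hb
  · rw [List.getD_eq_default _ _ (by simp; omega)] at hb
    exact absurd hb (by simp)

/-- A new bit forbids at most one more component, and only of a genuine test. When `h.length = 2 *
e`, the index `stageExponent K (2 * e + 1)` of that component is the exponent of the next stage, so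
the loss matches what the invariant can afford. -/
theorem measure_forbidden_concat {p : unitInterval} {K : ℕ} {h : List Bool} {b : Bool}
    (hb : b = true → ∀ e, h.length = 2 * e → e ∈ testCodes p) (A : Set Cantor) :
    (bernoulli p).real (A \ forbidden K (binaryExpansion p) h) ≤
      (bernoulli p).real (A \ forbidden K (binaryExpansion p) (h ++ [b])) +
        2⁻¹ ^ stageExponent K (h.length + 1) := by
  set X : Set Cantor := {x | ∃ e, h.length = 2 * e ∧ b = true ∧
    x ∈ effectiveOpen e (binaryExpansion p) (stageExponent K (2 * e + 1))} with hX
  have hsub : A \ forbidden K (binaryExpansion p) h ⊆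
      (A \ forbidden K (binaryExpansion p) (h ++ [b])) ∪ X := by
    rintro x ⟨hA, hx⟩
    by_cases hx' : x ∈ forbidden K (binaryExpansion p) (h ++ [b])
    · exact Or.inr ((forbidden_concat_subset K _ h b hx').resolve_left hx)
    · exact Or.inl ⟨hA, hx'⟩
  have hXm : (bernoulli p).real X ≤ 2⁻¹ ^ stageExponent K (h.length + 1) := by
    by_cases hc : b = true ∧ ∃ e, h.length = 2 * e
    · obtain ⟨hbt, e, he⟩ := hc
      have hXe : X ⊆ effectiveOpen e (binaryExpansion p) (stageExponent K (h.length + 1)) := by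
        rintro x ⟨e', he', -, hx⟩
        obtain rfl : e' = e := by omega
        rwa [he]
      refine (measureReal_mono hXe).trans ?_
      have := ENNReal.toReal_mono (by simp) (hb hbt e he (stageExponent K (h.length + 1)))
      simpa [Measure.real] using this
    · have : X = ∅ := by
        ext x
        simp only [hX, Set.mem_ofPred_eq, Set.mem_empty_iff_false, iff_false]
        rintro ⟨e, he, hbt, -⟩
        exact hc ⟨hbt, e, he⟩
      rw [this]
      simp
  calc _ ≤ _ := measureReal_mono hsub
    _ ≤ _ := measureReal_union_le _ _
    _ ≤ _ := by gcongr

/-- Either bit has probability at most `1 - 1 / N ≤ exp (-1 / N)`, so `N * m` bits give at most `exp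
(-m) ≤ 2 ^ (-m)`. -/
theorem real_cylinder_le_exp {p : unitInterval} {N : ℕ} (hN₀ : 1 ≤ N * (p : ℝ))
    (hN₁ : 1 ≤ N * (1 - (p : ℝ))) {m : ℕ} {τ : List Bool} (hτ : τ.length = N * m) :
    (bernoulli p).real (cylinder τ) ≤ 2⁻¹ ^ m := by
  have hp₀ : (0 : ℝ) ≤ p := p.2.1
  have hp₁ : (0 : ℝ) ≤ 1 - p := sub_nonneg.2 p.2.2
  have hN : (0 : ℝ) < N := by
    rcases Nat.eq_zero_or_pos N with rfl | h
    · norm_num at hN₀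
    · exact_mod_cast h
  have hi₀ : (N : ℝ)⁻¹ ≤ p := by rwa [inv_le_iff_one_le_mul₀' hN]
  have hi₁ : (N : ℝ)⁻¹ ≤ 1 - p := by rwa [inv_le_iff_one_le_mul₀' hN]
  have he : 1 - (N : ℝ)⁻¹ ≤ Real.exp (-(N : ℝ)⁻¹) := by
    have := Real.add_one_le_exp (-(N : ℝ)⁻¹); linarith
  have h₀ : (p : ℝ) ≤ Real.exp (-(N : ℝ)⁻¹) := by linarith
  have h₁ : 1 - (p : ℝ) ≤ Real.exp (-(N : ℝ)⁻¹) := by linarith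
  rw [bernoulli_real_cylinder]
  calc (p : ℝ) ^ τ.count false * (1 - (p : ℝ)) ^ τ.count true
      ≤ Real.exp (-(N : ℝ)⁻¹) ^ τ.count false * Real.exp (-(N : ℝ)⁻¹) ^ τ.count true := by
        gcongr
    _ = Real.exp (-(N : ℝ)⁻¹) ^ (N * m) := by
        rw [← pow_add, count_false_add_count_true, hτ]
    _ = Real.exp (-1) ^ m := by
        rw [pow_mul, ← Real.exp_nat_mul]
        congr 2
        field_simp
    _ ≤ 2⁻¹ ^ m := by
        gcongr
        rw [Real.exp_neg]
        have := Real.add_one_le_exp 1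
        gcongr
        linarith

open Classical in
/-- At least two of the extensions of a position never die. -/
theorem one_lt_card_not_dead {p : unitInterval} (hp : p < 1) {N : ℕ} (hN₀ : 1 ≤ N * (p : ℝ))
    (hN₁ : 1 ≤ N * (1 - (p : ℝ))) {h σ : List Bool} (hσ : Position p (4 * N) h σ) :
    1 < ((strings ((4 * N) ^ (h.length + 2) - (4 * N) ^ (h.length + 1))).toFinset.filter
      fun ρ => ∀ k, ¬ Dead (4 * N) (initSeg (binaryExpansion p) k) h (σ ++ ρ)).card := by
  by_contra! hcard
  obtain ⟨hlen, hmeas⟩ := hσ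
  have hN : 0 < N := by
    rcases Nat.eq_zero_or_pos N with rfl | h
    · norm_num at hN₀
    · exact h
  set K := 4 * N with hK
  set l := K ^ (h.length + 1) with hl
  set l' := K ^ (h.length + 2) with hl'
  have hl4 : 4 ≤ l := by
    rw [hl, pow_succ]
    calc 4 ≤ K := by omega
      _ ≤ _ := Nat.le_mul_of_pos_left _ (by positivity)
  have hll : l' = N * (4 * l) := by rw [hl', pow_succ, ← hl, hK]; ring
  have hll' : 4 * l ≤ l' := by rw [hll]; exact Nat.le_mul_of_pos_left _ hN
  set F := forbidden K (binaryExpansion p) h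
  set S := (strings (l' - l)).toFinset with hS
  set G := S.filter fun ρ => ∀ k, ¬ Dead K (initSeg (binaryExpansion p) k) h (σ ++ ρ)
  set m : List Bool → ℝ := fun ρ => (bernoulli p).real (cylinder (σ ++ ρ) \ F) with hm
  have hlenρ : ∀ ρ ∈ S, (σ ++ ρ).length = l' := by
    intro ρ hρ
    rw [hS, List.mem_toFinset, mem_strings] at hρ
    rw [List.length_append, hlen, hρ]
    omega
  have hcover : cylinder σ \ F ⊆ ⋃ ρ ∈ S, cylinder (σ ++ ρ) \ F := by
    rintro x ⟨hx, hF⟩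
    simp only [Set.mem_iUnion]
    rw [mem_cylinder_iff_prefix x σ (k := l') (by omega)] at hx
    obtain ⟨ρ, hρ⟩ := hx
    have hρl : ρ.length = l' - l := by
      have := congrArg List.length hρ
      rw [List.length_append, hlen, length_initSeg] at this
      omega
    have hρS : ρ ∈ S := by rw [hS, List.mem_toFinset, mem_strings, hρl]
    refine ⟨ρ, hρS, ?_, hF⟩
    rw [mem_cylinder_iff, hlenρ ρ hρS, hρ]
  have hsum : (bernoulli p).real (cylinder σ \ F) ≤ ∑ ρ ∈ S, m ρ :=
    (measureReal_mono hcover (measure_ne_top _ _)).trans (measureReal_biUnion_finset_le _ _)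
  rw [← Finset.sum_filter_add_sum_filter_not S
    (fun ρ => ∀ k, ¬ Dead K (initSeg (binaryExpansion p) k) h (σ ++ ρ))] at hsum
  -- The factor `4` in `K = 4 * N` is used here: length `l' = N * (4 * l)` makes a single cylinder
  -- smaller than `2 ^ (-4 * l)`, well below the required `2 ^ (-2 * l)`.
  have hG : ∑ ρ ∈ G, m ρ ≤ 2⁻¹ ^ (4 * l) := by
    have h₁ : ∀ ρ ∈ G, m ρ ≤ 2⁻¹ ^ (4 * l) := by
      intro ρ hρ
      refine (measureReal_mono Set.sdiff_subset).trans
        (real_cylinder_le_exp hN₀ hN₁ ?_)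
      rw [hlenρ ρ (Finset.mem_filter.1 hρ).1, hll]
    refine (Finset.sum_le_card_nsmul _ _ _ h₁).trans ?_
    rw [nsmul_eq_mul]
    have : (G.card : ℝ) ≤ 1 := by exact_mod_cast hcard
    exact mul_le_of_le_one_left (by positivity) this
  -- There are at most `2 ^ (l' - l)` dead extensions, and each keeps less than `4 * 2 ^ (-2 * l')`.
  have hD : ∑ ρ ∈ S.filter (fun ρ => ¬ ∀ k, ¬ Dead K (initSeg (binaryExpansion p) k) h
      (σ ++ ρ)), m ρ ≤ 2 ^ (l' - l) * (4 * 2⁻¹ ^ (2 * l')) := by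
    have h₁ : ∀ ρ ∈ S.filter (fun ρ => ¬ ∀ k, ¬ Dead K (initSeg (binaryExpansion p) k) h
        (σ ++ ρ)), m ρ ≤ 4 * 2⁻¹ ^ (2 * l') := by
      intro ρ hρ
      have hρ' := (Finset.mem_filter.1 hρ).2
      push Not at hρ'
      obtain ⟨k, hk⟩ := hρ'
      have := hk.measure_lt hp
      rw [inv_pow, ← div_eq_mul_inv, le_div_iff₀ (by positivity)]
      exact this.le
    refine (Finset.sum_le_card_nsmul _ _ _ h₁).trans ?_
    rw [nsmul_eq_mul]
    gcongr
    have : (S.filter (fun ρ => ¬ ∀ k, ¬ Dead K (initSeg (binaryExpansion p) k) h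
        (σ ++ ρ))).card ≤ 2 ^ (l' - l) :=
      (Finset.card_filter_le _ _).trans ((List.toFinset_card_le _).trans (length_strings _).le)
    exact_mod_cast this
  have hb : stageExponent K h.length = 2 * l := rfl
  rw [hb] at hmeas
  have e₁ : (2⁻¹ : ℝ) ^ (4 * l) * 2 ^ (2 * l) ≤ 2⁻¹ ^ 2 := by
    have : (2⁻¹ : ℝ) ^ (4 * l) = 2⁻¹ ^ (2 * l) * 2⁻¹ ^ (2 * l) := by rw [← pow_add]; congr 1; ring
    rw [this, mul_assoc, ← mul_pow, inv_mul_cancel₀ two_ne_zero, one_pow, mul_one]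
    exact pow_le_pow_of_le_one (by norm_num) (by norm_num) (by omega)
  have e₂ : (2 : ℝ) ^ (l' - l) * (4 * 2⁻¹ ^ (2 * l')) * 2 ^ (2 * l) ≤ 2⁻¹ ^ 2 := by
    obtain ⟨d, hd⟩ := Nat.exists_eq_add_of_le (show l + 4 ≤ l' by omega)
    have h₁ : l' - l = d + 4 := by omega
    have h₂ : 2 * l' = (d + 4) + (2 * l + (d + 4)) := by omega
    rw [h₁, h₂, pow_add (2⁻¹ : ℝ) (d + 4), pow_add (2⁻¹ : ℝ) (2 * l)]
    have h₃ : (2 : ℝ) ^ (d + 4) * 2⁻¹ ^ (d + 4) = 1 := by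
      rw [← mul_pow, mul_inv_cancel₀ two_ne_zero, one_pow]
    have h₄ : (2 : ℝ) ^ (2 * l) * 2⁻¹ ^ (2 * l) = 1 := by
      rw [← mul_pow, mul_inv_cancel₀ two_ne_zero, one_pow]
    have h₅ : (2⁻¹ : ℝ) ^ (d + 4) ≤ 2⁻¹ ^ 4 :=
      pow_le_pow_of_le_one (by norm_num) (by norm_num) (by omega)
    calc _ = 4 * ((2 : ℝ) ^ (d + 4) * 2⁻¹ ^ (d + 4)) * (2 ^ (2 * l) * 2⁻¹ ^ (2 * l)) *
          2⁻¹ ^ (d + 4) := by ring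
      _ ≤ 4 * 1 * 1 * 2⁻¹ ^ 4 := by rw [h₃, h₄]; gcongr
      _ = _ := by norm_num
  -- Measured in units of `2 ^ (-2 * l)`, the lone survivor and the dead extensions contribute at
  -- most a quarter each, while the position has at least one unit.
  have hfin : (1 : ℝ) ≤ 2⁻¹ ^ 2 + 2⁻¹ ^ 2 := by
    calc (1 : ℝ) ≤ _ := hmeas
      _ ≤ (2⁻¹ ^ (4 * l) + 2 ^ (l' - l) * (4 * 2⁻¹ ^ (2 * l'))) * 2 ^ (2 * l) := by
          gcongr
          exact hsum.trans (add_le_add hG hD)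
      _ ≤ _ := by rw [add_mul]; exact add_le_add e₁ e₂
  norm_num at hfin

/-- Every position has, for either bit, a next position that codes this bit. -/
theorem Position.exists_next {p : unitInterval} (hp : p < 1) {N : ℕ} (hN₀ : 1 ≤ N * (p : ℝ))
    (hN₁ : 1 ≤ N * (1 - (p : ℝ))) {h σ : List Bool} (hσ : Position p (4 * N) h σ) {b : Bool}
    (hb : b = true → ∀ e, h.length = 2 * e → e ∈ testCodes p) :
    ∃ τ, σ <+: τ ∧ Position p (4 * N) (h ++ [b]) τ ∧
      (∃ k, Decodes (4 * N) (initSeg (binaryExpansion p) k) h τ b) ∧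
      ∀ k, ¬ Decodes (4 * N) (initSeg (binaryExpansion p) k) h τ (!b) := by
  classical
  have hcard := one_lt_card_not_dead hp hN₀ hN₁ hσ
  have hN : 0 < N := by
    rcases Nat.eq_zero_or_pos N with rfl | h
    · norm_num at hN₀
    · exact h
  have hlen := hσ.1
  set K := 4 * N with hK
  set L := K ^ (h.length + 2) - K ^ (h.length + 1) with hL
  set z := binaryExpansion p
  have hle : K ^ (h.length + 1) ≤ K ^ (h.length + 2) :=
    Nat.pow_le_pow_right (by omega) (by omega)
  set G := (strings L).toFinset.filter fun ρ => ∀ k, ¬ Dead K (initSeg z k) h (σ ++ ρ) with hG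
  have hpos : 0 < G.card := by omega
  -- The extreme survivors in the order of codes are the two code words; they differ because there
  -- are at least two survivors.
  obtain ⟨ρ₀, hρ₀, hmin⟩ := G.exists_min_image (fun ρ => Encodable.encode (σ ++ ρ))
    (Finset.card_pos.1 hpos)
  obtain ⟨ρ₁, hρ₁, hmax⟩ := G.exists_max_image (fun ρ => Encodable.encode (σ ++ ρ))
    (Finset.card_pos.1 hpos)
  have hlt : Encodable.encode (σ ++ ρ₀) < Encodable.encode (σ ++ ρ₁) := by
    obtain ⟨a, ha, c, hc, hac⟩ := Finset.one_lt_card.1 hcard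
    have hne : Encodable.encode (σ ++ a) ≠ Encodable.encode (σ ++ c) := fun he =>
      hac (List.append_cancel_left (Encodable.encode_injective he))
    have := hmin a ha; have := hmin c hc; have := hmax a ha; have := hmax c hc
    omega
  have htake : ∀ ρ : List Bool, (σ ++ ρ).take (K ^ (h.length + 1)) = σ := fun ρ => by
    rw [← hlen, List.take_left']; rfl
  -- Finitely many deaths are all visible from one sufficiently long part of the oracle.
  have hmono : ∀ Q : List Bool → Prop,
      (∀ ρ ∈ strings L, Q ρ → ∃ k, Dead K (initSeg z k) h (σ ++ ρ)) →
      ∃ k, ∀ ρ ∈ strings L, Q ρ → Dead K (initSeg z k) h (σ ++ ρ) := by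
    intro Q hQ
    choose! f hf using hQ
    refine ⟨(strings L).toFinset.sup f, fun ρ hρ hq => (hf ρ hρ hq).mono (initSeg_prefix _ ?_)⟩
    exact Finset.le_sup (List.mem_toFinset.2 hρ)
  -- In units of `2 ^ (-stageExponent K (h.length + 1))`, a survivor has at least `2` and the newly
  -- forbidden set takes at most `1`, which leaves the required `1`.
  have hposn : ∀ ρ ∈ G, Position p K (h ++ [b]) (σ ++ ρ) := by
    intro ρ hρ
    rw [hG, Finset.mem_filter, List.mem_toFinset, mem_strings] at hρ
    refine ⟨?_, ?_⟩
    · rw [List.length_append, hlen, hρ.1, List.length_append, List.length_singleton]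
      change _ = K ^ (h.length + 2)
      omega
    · have h₁ := le_measure_of_forall_not_dead hp hN₀ hN₁ hρ.2
      have h₂ := measure_forbidden_concat (K := K) hb (cylinder (σ ++ ρ))
      rw [List.length_append, List.length_singleton]
      have h₃ : (2⁻¹ : ℝ) ^ stageExponent K (h.length + 1) *
          2 ^ stageExponent K (h.length + 1) = 1 := by
        rw [← mul_pow, inv_mul_cancel₀ two_ne_zero, one_pow]
      have h₄ := mul_le_mul_of_nonneg_right h₂
        (by positivity : (0 : ℝ) ≤ 2 ^ stageExponent K (h.length + 1))
      rw [add_mul, h₃] at h₄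
      linarith
  have hmemG : ∀ ρ ∈ strings L, ρ ∉ G → ∃ k, Dead K (initSeg z k) h (σ ++ ρ) := by
    intro ρ hρ hn
    by_contra! hc
    exact hn (Finset.mem_filter.2 ⟨List.mem_toFinset.2 hρ, hc⟩)
  have hGs : ∀ ρ ∈ G, ρ ∈ strings L := fun ρ hρ =>
    List.mem_toFinset.1 (Finset.mem_filter.1 hρ).1
  cases b with
  | false =>
    refine ⟨σ ++ ρ₀, List.prefix_append _ _, hposn _ hρ₀, ?_, fun k hd => ?_⟩
    · obtain ⟨k, hk⟩ := hmono (fun ρ => Encodable.encode (σ ++ ρ) < Encodable.encode (σ ++ ρ₀))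
        fun ρ hρ hq => hmemG ρ hρ fun hmem => absurd (hmin ρ hmem) (by omega)
      refine ⟨k, fun ρ hρ hq => ?_⟩
      rw [htake] at hq ⊢
      exact hk ρ hρ (by simpa using hq)
    -- The greatest survivor is a larger competitor that never dies, so the opposite bit is never
    -- read; the case of the bit `true` is symmetric.
    · have := hd ρ₁ (hGs _ hρ₁) (by rw [htake]; simpa using hlt)
      rw [htake] at this
      exact (Finset.mem_filter.1 hρ₁).2 k this
  | true =>
    refine ⟨σ ++ ρ₁, List.prefix_append _ _, hposn _ hρ₁, ?_, fun k hd => ?_⟩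
    · obtain ⟨k, hk⟩ := hmono (fun ρ => Encodable.encode (σ ++ ρ₁) < Encodable.encode (σ ++ ρ))
        fun ρ hρ hq => hmemG ρ hρ fun hmem => absurd (hmax ρ hmem) (by omega)
      refine ⟨k, fun ρ hρ hq => ?_⟩
      rw [htake] at hq ⊢
      exact hk ρ hρ (by simpa using hq)
    · have := hd ρ₀ (hGs _ hρ₀) (by rw [htake]; simpa using hlt)
      rw [htake] at this
      exact (Finset.mem_filter.1 hρ₀).2 k this

theorem primrecPred_decodes (K : ℕ) :
    PrimrecPred fun a : List Bool × List Bool × List Bool × Bool =>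
      Decodes K a.1 a.2.1 a.2.2.1 a.2.2.2 := by
  have hh : Primrec fun a : List Bool × List Bool × List Bool × Bool => a.2.1.length :=
    Primrec.list_length.comp (Primrec.fst.comp Primrec.snd)
  have hl : ∀ c, Primrec fun a : List Bool × List Bool × List Bool × Bool =>
      K ^ (a.2.1.length + c) := fun c =>
    primrec_pow.comp (Primrec.const K) (Primrec.nat_add.comp hh (Primrec.const c))
  have hτ : Primrec fun a : List Bool × List Bool × List Bool × Bool => a.2.2.1 :=
    Primrec.fst.comp (Primrec.snd.comp Primrec.snd)
  have hc : Primrec fun b : List Bool × List Bool × List Bool × List Bool × Bool =>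
      b.2.2.2.1.take (K ^ (b.2.2.1.length + 1)) ++ b.1 :=
    Primrec.list_append.comp (Primrec.list_take.comp ((hl 1).comp Primrec.snd)
      (hτ.comp Primrec.snd)) Primrec.fst
  have hbit : PrimrecPred fun b : List Bool × List Bool × List Bool × List Bool × Bool =>
      b.2.2.2.2 = true := Primrec.eq.comp
    (Primrec.snd.comp (Primrec.snd.comp (Primrec.snd.comp Primrec.snd))) (Primrec.const true)
  have hd : PrimrecPred fun b : List Bool × List Bool × List Bool × List Bool × Bool =>
      Dead K b.2.1 b.2.2.1 (b.2.2.2.1.take (K ^ (b.2.2.1.length + 1)) ++ b.1) :=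
    (primrecPred_dead K).comp
      (f := fun b : List Bool × List Bool × List Bool × List Bool × Bool =>
        (b.2.1, b.2.2.1, b.2.2.2.1.take (K ^ (b.2.2.1.length + 1)) ++ b.1))
      ((Primrec.fst.comp Primrec.snd).pair
        ((Primrec.fst.comp (Primrec.snd.comp Primrec.snd)).pair hc))
  have hlt₁ : PrimrecPred fun b : List Bool × List Bool × List Bool × List Bool × Bool =>
      Encodable.encode b.2.2.2.1 <
        Encodable.encode (b.2.2.2.1.take (K ^ (b.2.2.1.length + 1)) ++ b.1) :=
    Primrec.nat_lt.comp (Primrec.encode.comp (hτ.comp Primrec.snd)) (Primrec.encode.comp hc)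
  have hlt₂ : PrimrecPred fun b : List Bool × List Bool × List Bool × List Bool × Bool =>
      Encodable.encode (b.2.2.2.1.take (K ^ (b.2.2.1.length + 1)) ++ b.1) <
        Encodable.encode b.2.2.2.1 :=
    Primrec.nat_lt.comp (Primrec.encode.comp hc) (Primrec.encode.comp (hτ.comp Primrec.snd))
  refine primrecPred_forall_mem
    (R := fun (ρ : List Bool) (a : List Bool × List Bool × List Bool × Bool) =>
      (if a.2.2.2 = true then
        Encodable.encode a.2.2.1 <
          Encodable.encode (a.2.2.1.take (K ^ (a.2.1.length + 1)) ++ ρ)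
      else Encodable.encode (a.2.2.1.take (K ^ (a.2.1.length + 1)) ++ ρ) <
          Encodable.encode a.2.2.1) →
      Dead K a.1 a.2.1 (a.2.2.1.take (K ^ (a.2.1.length + 1)) ++ ρ)) ?_
    (primrec_strings.comp (Primrec.nat_sub.comp (hl 2) (hl 1)))
  refine ((((hbit.and hlt₁).or (hbit.not.and hlt₂)).not).or hd).of_eq fun b => ?_
  by_cases h : b.2.2.2.2 = true <;> simp [h, imp_iff_not_or]

/-! ### Frequencies and the computation of the parameter -/

/-- The indicator of the bit `0` at position `i`. -/
def zeroIndicator (i : ℕ) (x : Cantor) : ℝ := if x i = false then 1 else 0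

theorem measurable_zeroIndicator (i : ℕ) : Measurable (zeroIndicator i) :=
  (Measurable.of_discrete (f := fun b : Bool => if b = false then (1 : ℝ) else 0)).comp
    (measurable_pi_apply i)

theorem zeroIndicator_mem_Icc (i : ℕ) (x : Cantor) : zeroIndicator i x ∈ Set.Icc (0 : ℝ) 1 := by
  unfold zeroIndicator; split_ifs <;> simp

theorem memLp_zeroIndicator (p : unitInterval) (i : ℕ) :
    MemLp (zeroIndicator i) 2 (bernoulli p) := by
  refine MemLp.of_bound (measurable_zeroIndicator i).aestronglyMeasurable 1
    (Filter.Eventually.of_forall fun x => ?_)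
  have := zeroIndicator_mem_Icc i x
  rw [Real.norm_of_nonneg this.1]
  exact this.2

theorem integral_zeroIndicator (p : unitInterval) (i : ℕ) :
    ∫ x, zeroIndicator i x ∂bernoulli p = p := by
  have hmp := measurePreserving_eval_infinitePi
    (fun _ : ℕ => ProbabilityTheory.bernoulliMeasure false true p) i
  have h := integral_map (μ := bernoulli p) hmp.measurable.aemeasurable
    (f := fun b : Bool => if b = false then (1 : ℝ) else 0)
    Measurable.of_discrete.aestronglyMeasurable
  have hmap : (bernoulli p).map (Function.eval i) =
      ProbabilityTheory.bernoulliMeasure false true p := hmp.map_eq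
  rw [hmap] at h
  refine h.symm.trans ?_
  have hind : (fun b : Bool => if b = false then (1 : ℝ) else 0) =
      Set.indicator {false} (fun _ => (1 : ℝ)) := by
    ext b; cases b <;> simp
  rw [hind, integral_indicator_const _ MeasurableSet.of_discrete,
    ProbabilityTheory.bernoulliMeasure_real_apply_of_mem_of_notMem] <;> simp

theorem sum_zeroIndicator (x : Cantor) (n : ℕ) :
    ∑ i ∈ Finset.range n, zeroIndicator i x = ((initSeg x n).count false : ℝ) := by
  induction n with
  | zero => simp [initSeg]
  | succ n ih =>
    rw [Finset.sum_range_succ, ih, initSeg_succ, List.count_append]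
    cases h : x n <;> simp [zeroIndicator, h]

/-- Chebyshev's inequality: the number of zeros among `16 ^ j` bits has variance at most `16 ^ j`,
and `16 ^ j / (8 ^ j) ^ 2 = 4 ^ (-j)`. -/
theorem measure_frequency_deviation_le (p : unitInterval) (j : ℕ) :
    bernoulli p {x | (8 : ℝ) ^ j ≤ |((initSeg x (16 ^ j)).count false : ℝ) - p * 16 ^ j|} ≤
      (2⁻¹ : ℝ≥0∞) ^ j := by
  set X : Cantor → ℝ := ∑ i ∈ Finset.range (16 ^ j), zeroIndicator i with hX
  have hXx : ∀ x, X x = ((initSeg x (16 ^ j)).count false : ℝ) := fun x => by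
    rw [hX, Finset.sum_apply, sum_zeroIndicator]
  have hXm : MemLp X 2 (bernoulli p) := memLp_finsetSum' _ fun i _ => memLp_zeroIndicator p i
  have hind : ProbabilityTheory.iIndepFun zeroIndicator (bernoulli p) :=
    ProbabilityTheory.iIndepFun_infinitePi
      (X := fun _ (b : Bool) => if b = false then (1 : ℝ) else 0)
      (fun _ => Measurable.of_discrete)
  have hE : ∫ x, X x ∂bernoulli p = p * 16 ^ j := by
    simp only [hX, Finset.sum_apply]
    rw [integral_finsetSum _ fun i _ => (memLp_zeroIndicator p i).integrable one_le_two]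
    simp [integral_zeroIndicator, mul_comm]
  have hV : ProbabilityTheory.variance X (bernoulli p) ≤ 16 ^ j := by
    rw [hX, ProbabilityTheory.IndepFun.variance_sum (fun i _ => memLp_zeroIndicator p i)
      fun i _ k _ hik => hind.indepFun hik]
    refine (Finset.sum_le_card_nsmul _ _ 1 fun i _ => ?_).trans (by simp)
    refine (ProbabilityTheory.variance_le_sq_of_bounded (a := 0) (b := 1)
      (Filter.Eventually.of_forall fun x => zeroIndicator_mem_Icc i x)
      (measurable_zeroIndicator i).aemeasurable).trans (by norm_num)
  have := ProbabilityTheory.meas_ge_le_variance_div_sq hXm (c := 8 ^ j) (by positivity)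
  rw [hE] at this
  simp only [hXx] at this
  refine this.trans ?_
  have h2 : (2⁻¹ : ℝ≥0∞) ^ j = ENNReal.ofReal (2⁻¹ ^ j) := by
    rw [ENNReal.ofReal_pow (by norm_num), ENNReal.ofReal_inv_of_pos (by norm_num)]
    simp
  rw [h2]
  refine ENNReal.ofReal_le_ofReal ?_
  rw [div_le_iff₀ (by positivity)]
  refine hV.trans ?_
  rw [← pow_mul, mul_comm j 2, pow_mul, ← mul_pow]
  gcongr
  norm_num

/-- There is a Martin-Löf test that forces the frequencies of the bit `0` to converge quickly. -/
theorem exists_frequency_test {p : unitInterval} (hp : p < 1) :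
    ∃ e ∈ testCodes p, ∀ x i, x ∉ effectiveOpen e (binaryExpansion p) i → ∀ j, i + 1 ≤ j →
      |((initSeg x (16 ^ j)).count false : ℝ) - p * 16 ^ j| ≤ 3 * 8 ^ j := by
  -- The first `4 * j` digits of `p` give `⌊p * 16 ^ j⌋`. The extra `1` absorbs the rounding, so a
  -- string listed here truly deviates by at least `8 ^ j`.
  let R : (List Bool × ℕ × ℕ) → List Bool → ℕ → Prop := fun a ρ j =>
    a.2.1 + 1 ≤ j ∧ 4 * j ≤ a.1.length ∧ ρ.length = 16 ^ j ∧
      (8 ^ j + 1 + ρ.count false < binaryValue (a.1.take (4 * j)) ∨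
        binaryValue (a.1.take (4 * j)) + (8 ^ j + 1) < ρ.count false)
  classical
  -- The stage number is read as a pair of a string and an exponent, so every candidate is tried at
  -- some stage.
  let g : List Bool × ℕ × ℕ → Option (List Bool) := fun a =>
    if R a ((Encodable.decode (α := List Bool) a.2.2.unpair.1).getD []) a.2.2.unpair.2
    then some ((Encodable.decode (α := List Bool) a.2.2.unpair.1).getD []) else none
  have hρ : Primrec fun a : List Bool × ℕ × ℕ =>
      (Encodable.decode (α := List Bool) a.2.2.unpair.1).getD [] :=
    Primrec.option_getD.comp (Primrec.decode.comp (Primrec.fst.comp (Primrec.unpair.comp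
      (Primrec.snd.comp Primrec.snd)))) (Primrec.const [])
  have hj : Primrec fun a : List Bool × ℕ × ℕ => a.2.2.unpair.2 :=
    Primrec.snd.comp (Primrec.unpair.comp (Primrec.snd.comp Primrec.snd))
  have h4 : Primrec fun a : List Bool × ℕ × ℕ => 4 * a.2.2.unpair.2 :=
    Primrec.nat_mul.comp (Primrec.const 4) hj
  have hv : Primrec fun a : List Bool × ℕ × ℕ => binaryValue (a.1.take (4 * a.2.2.unpair.2)) :=
    primrec_binaryValue.comp (Primrec.list_take.comp h4 Primrec.fst)
  have h8 : Primrec fun a : List Bool × ℕ × ℕ => 8 ^ a.2.2.unpair.2 + 1 :=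
    Primrec.succ.comp (primrec_pow.comp (Primrec.const 8) hj)
  have hct := (primrec_count false).comp hρ
  have hR : PrimrecPred fun a : List Bool × ℕ × ℕ =>
      R a ((Encodable.decode (α := List Bool) a.2.2.unpair.1).getD []) a.2.2.unpair.2 := by
    refine PrimrecPred.and ?_ (PrimrecPred.and ?_ (PrimrecPred.and ?_ (PrimrecPred.or ?_ ?_)))
    · exact Primrec.nat_le.comp (Primrec.succ.comp (Primrec.fst.comp Primrec.snd)) hj
    · exact Primrec.nat_le.comp h4 (Primrec.list_length.comp Primrec.fst)
    · exact Primrec.eq.comp (Primrec.list_length.comp hρ)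
        (primrec_pow.comp (Primrec.const 16) hj)
    · exact Primrec.nat_lt.comp (Primrec.nat_add.comp h8 hct) hv
    · exact Primrec.nat_lt.comp (Primrec.nat_add.comp hv h8) hct
  have hg : Primrec g := Primrec.ite hR (Primrec.option_some.comp hρ) (Primrec.const none)
  obtain ⟨e, he⟩ := exists_code_of_computable hg.to_comp
  have h16 : ∀ j : ℕ, (2 : ℝ) ^ (4 * j) = 16 ^ j := fun j => by rw [pow_mul]; norm_num
  have hval : ∀ k j, 4 * j ≤ k →
      ((binaryValue ((initSeg (binaryExpansion p) k).take (4 * j)) : ℝ) ≤ p * 16 ^ j ∧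
      p * 16 ^ j < (binaryValue ((initSeg (binaryExpansion p) k).take (4 * j)) : ℝ) + 1) := by
    intro k j h
    rw [take_initSeg _ h, ← h16]
    exact ⟨binaryValue_initSeg_le hp _, lt_binaryValue_initSeg hp _⟩
  refine ⟨e, fun i => ?_, fun x i hx j hij => ?_⟩
  · have hsub : effectiveOpen e (binaryExpansion p) i ⊆ ⋃ j : ℕ,
        {x | (8 : ℝ) ^ (i + (j + 1)) ≤
          |((initSeg x (16 ^ (i + (j + 1)))).count false : ℝ) - p * 16 ^ (i + (j + 1))|} := by
      rw [he]
      rintro x ⟨k, s, ρ, hgs, hx⟩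
      simp only [g] at hgs
      split_ifs at hgs with hRs
      obtain rfl := Option.some.inj hgs
      generalize (Encodable.decode (α := List Bool) s.unpair.1).getD [] = ρ at hRs hx
      generalize s.unpair.2 = j at hRs
      obtain ⟨h₁, h₂, h₃, h₄⟩ := hRs
      simp only [length_initSeg] at h₁ h₂
      obtain ⟨d, rfl⟩ := Nat.exists_eq_add_of_le h₁
      obtain ⟨hv₁, hv₂⟩ := hval k _ h₂
      refine Set.mem_iUnion.2 ⟨d, ?_⟩
      rw [mem_cylinder_iff, h₃] at hx
      have hd : i + 1 + d = i + (d + 1) := by ring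
      rw [hd] at hx h₄ hv₁ hv₂
      rw [Set.mem_ofPred_eq, hx, le_abs]
      rcases h₄ with h₄ | h₄
      · right
        have : (8 : ℝ) ^ (i + (d + 1)) + 1 + ρ.count false <
          binaryValue ((initSeg (binaryExpansion p) k).take (4 * (i + (d + 1)))) := by
            exact_mod_cast h₄
        linarith
      · left
        have : (binaryValue ((initSeg (binaryExpansion p) k).take (4 * (i + (d + 1)))) : ℝ) +
          (8 ^ (i + (d + 1)) + 1) < ρ.count false := by exact_mod_cast h₄
        linarith
    -- The exponents start at `i + 1`, and the geometric sum of `2 ^ (-j)` over `j ≥ i + 1` is `2 ^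
    -- (-i)`.
    refine (measure_mono hsub).trans ((measure_iUnion_le _).trans ?_)
    refine (ENNReal.tsum_le_tsum fun j => measure_frequency_deviation_le p _).trans ?_
    simp only [pow_add _ i]
    rw [ENNReal.tsum_mul_left, ENNReal.tsum_geometric_add_one, ENNReal.one_sub_inv_two, inv_inv,
      ENNReal.inv_mul_cancel two_ne_zero (by simp), mul_one]
  -- The stage `0` is arbitrary, since `R` does not look at it.
  · have hn : ¬ R (initSeg (binaryExpansion p) (4 * j), i, 0) (initSeg x (16 ^ j)) j := by
      intro hR
      apply hx
      rw [he]
      refine ⟨4 * j, Nat.pair (Encodable.encode (initSeg x (16 ^ j))) j, initSeg x (16 ^ j), ?_,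
        by simp [mem_cylinder_iff]⟩
      have : R (initSeg (binaryExpansion p) (4 * j), i,
        Nat.pair (Encodable.encode (initSeg x (16 ^ j))) j) (initSeg x (16 ^ j)) j := hR
      simp [g, this]
    have hn' : ¬ (8 ^ j + 1 + (initSeg x (16 ^ j)).count false <
        binaryValue ((initSeg (binaryExpansion p) (4 * j)).take (4 * j)) ∨
        binaryValue ((initSeg (binaryExpansion p) (4 * j)).take (4 * j)) + (8 ^ j + 1) <
          (initSeg x (16 ^ j)).count false) := fun hor =>
      hn ⟨hij, by simp, by simp, hor⟩
    push Not at hn'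
    obtain ⟨h₁, h₂⟩ := hn'
    obtain ⟨hv₁, hv₂⟩ := hval (4 * j) j le_rfl
    have h₁' : (binaryValue ((initSeg (binaryExpansion p) (4 * j)).take (4 * j)) : ℝ) ≤
        8 ^ j + 1 + (initSeg x (16 ^ j)).count false := by exact_mod_cast h₁
    have h₂' : ((initSeg x (16 ^ j)).count false : ℝ) ≤
        binaryValue ((initSeg (binaryExpansion p) (4 * j)).take (4 * j)) + (8 ^ j + 1) := by
      exact_mod_cast h₂
    -- The deviation is at most `8 ^ j + 2`: one unit from the slack in `R` and one from rounding
    -- `p`. This is at most `3 * 8 ^ j`.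
    have h8' : (1 : ℝ) ≤ 8 ^ j := one_le_pow₀ (by norm_num)
    rw [abs_le]
    constructor <;> linarith

theorem eq_initSeg_of_bounds {p : unitInterval} (hp : p < 1) {π : List Bool}
    (h₁ : (binaryValue π : ℝ) ≤ p * 2 ^ π.length)
    (h₂ : p * 2 ^ π.length < (binaryValue π : ℝ) + 1) :
    π = initSeg (binaryExpansion p) π.length := by
  refine binaryValue_injective (by simp) ?_
  rw [binaryValue_initSeg hp, eq_comm, Nat.floor_eq_iff (h₁.trans' (by positivity))]
  exact ⟨h₁, h₂⟩

/-- If the frequencies of the bit `0` in `x` converge quickly to `p`, then the initial segments of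
the binary expansion of `p` can be recognized from `x`. -/
theorem exists_expansion_certificate {p : unitInterval} (hp : p < 1) {x : Cantor} {i : ℕ}
    (hx : ∀ j, i + 1 ≤ j →
      |((initSeg x (16 ^ j)).count false : ℝ) - p * 16 ^ j| ≤ 3 * 8 ^ j) :
    ∃ Q : List Bool → List Bool → Prop, PrimrecPred (fun a : List Bool × List Bool => Q a.1 a.2) ∧
      (∀ w π, Q (initSeg x w) π → π = initSeg (binaryExpansion p) π.length) ∧
      ∀ t, ∃ w₀, ∀ w, w₀ ≤ w → Q (initSeg x w) (initSeg (binaryExpansion p) t) := by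
  have hp₀ : (0 : ℝ) ≤ p := p.2.1
  have hv : Primrec fun a : List Bool × List Bool => binaryValue a.2 :=
    primrec_binaryValue.comp Primrec.snd
  have h2 : Primrec fun a : List Bool × List Bool => 2 ^ a.2.length :=
    primrec_pow.comp (Primrec.const 2) (Primrec.list_length.comp Primrec.snd)
  -- For a dyadic `p` approximations may never separate `p` from an endpoint of a dyadic interval.
  -- Then `p` is a fixed fraction, and the comparison is made directly with its numerator and
  -- denominator.
  by_cases hdy : ∃ t₀ a : ℕ, (p : ℝ) * 2 ^ t₀ = a
  · obtain ⟨t₀, a, ha⟩ := hdy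
    have hpa : (p : ℝ) = a / 2 ^ t₀ := by rw [← ha]; field_simp
    have key : ∀ π : List Bool, (binaryValue π * 2 ^ t₀ ≤ a * 2 ^ π.length ∧
        a * 2 ^ π.length < (binaryValue π + 1) * 2 ^ t₀) ↔
        ((binaryValue π : ℝ) ≤ p * 2 ^ π.length ∧
          p * 2 ^ π.length < (binaryValue π : ℝ) + 1) := by
      intro π
      rw [hpa, div_mul_eq_mul_div, le_div_iff₀ (by positivity), div_lt_iff₀ (by positivity)]
      norm_cast
    refine ⟨fun _ π => binaryValue π * 2 ^ t₀ ≤ a * 2 ^ π.length ∧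
      a * 2 ^ π.length < (binaryValue π + 1) * 2 ^ t₀, PrimrecPred.and ?_ ?_, ?_, ?_⟩
    · exact Primrec.nat_le.comp (Primrec.nat_mul.comp hv (Primrec.const _))
        (Primrec.nat_mul.comp (Primrec.const _) h2)
    · exact Primrec.nat_lt.comp (Primrec.nat_mul.comp (Primrec.const _) h2)
        (Primrec.nat_mul.comp (Primrec.succ.comp hv) (Primrec.const _))
    · intro w π h
      obtain ⟨h₁, h₂⟩ := (key π).1 h
      exact eq_initSeg_of_bounds hp h₁ h₂
    · refine fun t => ⟨0, fun w _ => (key _).2 ?_⟩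
      rw [length_initSeg]
      exact ⟨binaryValue_initSeg_le hp t, lt_binaryValue_initSeg hp t⟩
  · push Not at hdy
    let c : List Bool → ℕ → ℕ := fun ξ j => (ξ.take (16 ^ j)).count false
    -- The certificate is a `j` for which the whole error interval around the observed frequency
    -- lies inside the dyadic interval described by `π`.
    refine ⟨fun ξ π => ∃ j < ξ.length, i + 1 ≤ j ∧ 16 ^ j ≤ ξ.length ∧
      binaryValue π * 16 ^ j + 3 * 8 ^ j * 2 ^ π.length ≤ c ξ j * 2 ^ π.length ∧
      (c ξ j + 3 * 8 ^ j) * 2 ^ π.length < (binaryValue π + 1) * 16 ^ j, ?_, ?_, ?_⟩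
    · refine primrecPred_exists_lt (R := fun (j : ℕ) (a : List Bool × List Bool) =>
        i + 1 ≤ j ∧ 16 ^ j ≤ a.1.length ∧
          binaryValue a.2 * 16 ^ j + 3 * 8 ^ j * 2 ^ a.2.length ≤ c a.1 j * 2 ^ a.2.length ∧
          (c a.1 j + 3 * 8 ^ j) * 2 ^ a.2.length < (binaryValue a.2 + 1) * 16 ^ j) ?_
        (Primrec.list_length.comp Primrec.fst)
      have h16 : Primrec fun b : ℕ × List Bool × List Bool => 16 ^ b.1 :=
        primrec_pow.comp (Primrec.const 16) Primrec.fst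
      have h8 : Primrec fun b : ℕ × List Bool × List Bool => 3 * 8 ^ b.1 :=
        Primrec.nat_mul.comp (Primrec.const 3) (primrec_pow.comp (Primrec.const 8) Primrec.fst)
      have hξ : Primrec fun b : ℕ × List Bool × List Bool => b.2.1 :=
        Primrec.fst.comp Primrec.snd
      have hc : Primrec fun b : ℕ × List Bool × List Bool => c b.2.1 b.1 :=
        (primrec_count false).comp (Primrec.list_take.comp h16 hξ)
      have hv' := hv.comp (Primrec.snd (α := ℕ) (β := List Bool × List Bool))
      have h2' := h2.comp (Primrec.snd (α := ℕ) (β := List Bool × List Bool))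
      refine PrimrecPred.and ?_ (PrimrecPred.and ?_ (PrimrecPred.and ?_ ?_))
      · exact Primrec.nat_le.comp (Primrec.const _) Primrec.fst
      · exact Primrec.nat_le.comp h16 (Primrec.list_length.comp hξ)
      · exact Primrec.nat_le.comp (Primrec.nat_add.comp (Primrec.nat_mul.comp hv' h16)
          (Primrec.nat_mul.comp h8 h2')) (Primrec.nat_mul.comp hc h2')
      · exact Primrec.nat_lt.comp (Primrec.nat_mul.comp (Primrec.nat_add.comp hc h8) h2')
          (Primrec.nat_mul.comp (Primrec.succ.comp hv') h16)
    · rintro w π ⟨j, -, hij, hj, h₁, h₂⟩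
      rw [length_initSeg] at hj
      simp only [c, take_initSeg _ hj] at h₁ h₂
      have hxj := abs_le.1 (hx j hij)
      set n := (initSeg x (16 ^ j)).count false
      have h₁' : (binaryValue π : ℝ) * 16 ^ j + 3 * 8 ^ j * 2 ^ π.length ≤
        n * 2 ^ π.length := by exact_mod_cast h₁
      have h₂' : ((n : ℝ) + 3 * 8 ^ j) * 2 ^ π.length < (binaryValue π + 1) * 16 ^ j := by
        exact_mod_cast h₂
      have hpos : (0 : ℝ) < 2 ^ π.length := by positivity
      have hpos' : (0 : ℝ) < 16 ^ j := by positivity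
      refine eq_initSeg_of_bounds hp (le_of_mul_le_mul_right ?_ hpos')
        (lt_of_mul_lt_mul_right ?_ hpos'.le)
      · have := mul_le_mul_of_nonneg_right hxj.2 hpos.le
        nlinarith
      · have := mul_le_mul_of_nonneg_right hxj.1 hpos.le
        nlinarith
    · intro t
      set V := binaryValue (initSeg (binaryExpansion p) t) with hV
      have hV₁ : (V : ℝ) < p * 2 ^ t := lt_of_le_of_ne (binaryValue_initSeg_le hp t)
        fun h => hdy t V h.symm
      have hV₂ : (p : ℝ) * 2 ^ t < V + 1 := lt_binaryValue_initSeg hp t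
      -- The `6` is twice the error constant `3`: once for the actual deviation and once for the
      -- margin demanded by the certificate. The gaps on both sides are positive because `p` is not
      -- dyadic.
      have hlim : Filter.Tendsto (fun j : ℕ => 6 * 2 ^ t * (2⁻¹ : ℝ) ^ j) Filter.atTop
          (nhds 0) := by
        have := (tendsto_pow_atTop_nhds_zero_of_lt_one (r := (2⁻¹ : ℝ)) (by norm_num)
          (by norm_num)).const_mul (6 * 2 ^ t)
        rwa [mul_zero] at this
      obtain ⟨j, hj₁, hj₂, hij⟩ := ((hlim.eventually_lt_const (sub_pos.2 hV₁)).and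
        ((hlim.eventually_lt_const (sub_pos.2 hV₂)).and
          (Filter.eventually_ge_atTop (i + 1)))).exists
      have hjlt : j < 16 ^ j := Nat.lt_pow_self (by norm_num)
      refine ⟨16 ^ j, fun w hw => ⟨j, ?_, hij, ?_, ?_⟩⟩
      · rw [length_initSeg]; omega
      · rwa [length_initSeg]
      · simp only [c, take_initSeg _ hw, length_initSeg, ← hV]
        have hxj := abs_le.1 (hx j hij)
        set n := (initSeg x (16 ^ j)).count false
        have hpos : (0 : ℝ) < 2 ^ t := by positivity
        have hpos' : (0 : ℝ) < 16 ^ j := by positivity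
        have h8 : (6 * 2 ^ t * (2⁻¹ : ℝ) ^ j) * 16 ^ j = 6 * 2 ^ t * 8 ^ j := by
          rw [mul_assoc, ← mul_pow]; norm_num
        have hj₁' := mul_lt_mul_of_pos_right hj₁ hpos'
        have hj₂' := mul_lt_mul_of_pos_right hj₂ hpos'
        rw [h8] at hj₁' hj₂'
        have hl := mul_le_mul_of_nonneg_right hxj.1 hpos.le
        have hr := mul_le_mul_of_nonneg_right hxj.2 hpos.le
        have g₁ : (V : ℝ) * 16 ^ j + 3 * 8 ^ j * 2 ^ t ≤ n * 2 ^ t := by nlinarith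
        have g₂ : ((n : ℝ) + 3 * 8 ^ j) * 2 ^ t < (V + 1) * 16 ^ j := by nlinarith
        exact ⟨by exact_mod_cast g₁, by exact_mod_cast g₂⟩

/-! ### Sequences that code other sequences -/

/-- The position `τ` follows the position `σ`, reached after the history `h`, and codes the
bit `b`. -/
structure NextPosition (p : unitInterval) (K : ℕ) (h σ : List Bool) (b : Bool) (τ : List Bool) :
    Prop where
  isPrefix : σ <+: τ
  position : Position p K (h ++ [b]) τ
  decodes : ∃ k, Decodes K (initSeg (binaryExpansion p) k) h τ b
  not_decodes : ∀ k, ¬ Decodes K (initSeg (binaryExpansion p) k) h τ (!b)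

/-- The strings `σ n` are initial segments of a sequence that codes `D`, and the bits of `D` at even
positions single out the `μ_p`-Martin-Löf tests. -/
structure CodingPath (p : unitInterval) (K : ℕ) (D : Cantor) (σ : ℕ → List Bool) : Prop where
  position : ∀ n, Position p K (initSeg D n) (σ n)
  next : ∀ n, NextPosition p K (initSeg D n) (σ n) (D n) (σ (n + 1))
  test : ∀ e, D (2 * e) = true ↔ e ∈ testCodes p

/-- The sequence with initial segments `σ n`. -/
def limitSeq (σ : ℕ → List Bool) : Cantor := fun i => (σ i).getD i false

namespace CodingPath

variable {p : unitInterval} {K : ℕ} {D : Cantor} {σ : ℕ → List Bool}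

theorem length_eq (hc : CodingPath p K D σ) (n : ℕ) : (σ n).length = K ^ (n + 1) := by
  rw [(hc.position n).1, length_initSeg]

theorem lt_length (hc : CodingPath p K D σ) (hK : 2 ≤ K) (n : ℕ) : n < (σ n).length := by
  rw [hc.length_eq]
  exact (Nat.lt_succ_self n).trans (Nat.lt_pow_self hK)

theorem prefix_of_le (hc : CodingPath p K D σ) {m n : ℕ} (h : m ≤ n) : σ m <+: σ n := by
  induction n, h using Nat.le_induction with
  | base => exact List.prefix_refl _
  | succ n _ ih => exact ih.trans (hc.next n).isPrefix

theorem getD_eq_limitSeq (hc : CodingPath p K D σ) (hK : 2 ≤ K) {i n : ℕ}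
    (hi : i < (σ n).length) : (σ n).getD i false = limitSeq σ i := by
  have key : ∀ {m n : ℕ}, m ≤ n → i < (σ m).length →
      (σ n).getD i false = (σ m).getD i false := by
    intro m n h hi
    obtain ⟨r, hr⟩ := hc.prefix_of_le h
    rw [← hr, List.getD_append _ _ _ _ hi]
  rcases le_total i n with h | h
  · exact key h (hc.lt_length hK i)
  · exact (key h hi).symm

theorem initSeg_limitSeq (hc : CodingPath p K D σ) (hK : 2 ≤ K) (n : ℕ) :
    initSeg (limitSeq σ) (K ^ (n + 1)) = σ n := by
  refine List.ext_getElem (by simp [hc.length_eq]) fun i h₁ h₂ => ?_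
  rw [← List.getD_eq_getElem _ false h₂, hc.getD_eq_limitSeq hK h₂]
  simp [initSeg]

/-- The coded path avoids a component of every test. -/
theorem limitSeq_notMem (hc : CodingPath p K D σ) (hK : 2 ≤ K) {e : ℕ} (he : e ∈ testCodes p) :
    limitSeq σ ∉ effectiveOpen e (binaryExpansion p) (stageExponent K (2 * e + 1)) := by
  rintro ⟨k, ρ, hE, hx⟩
  -- Far enough for the history to contain the bit that activates `e` and for `σ n` to extend `ρ`.
  set n := max (2 * e + 1) ρ.length with hn
  have hl : ρ.length ≤ (σ n).length := (le_max_right _ _).trans (hc.lt_length hK n).le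
  have hpre : ρ <+: σ n := by
    rw [← hc.initSeg_limitSeq hK n, ← hc.length_eq n]
    exact (mem_cylinder_iff_prefix _ _ hl).1 hx
  have hbit : (initSeg D n).getD (2 * e) false = true := by
    rw [List.getD_eq_getElem?_getD, getElem?_initSeg D (by omega), Option.getD_some]
    exact (hc.test e).2 he
  -- Otherwise the entire cylinder of `σ n` would be forbidden, against the positive measure kept at
  -- every position.
  have hempty : cylinder (σ n) \ forbidden K (binaryExpansion p) (initSeg D n) = ∅ := by
    rw [Set.sdiff_eq_empty]
    intro x hxn
    refine ⟨e, hbit, k, ρ, hE, ?_⟩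
    rw [mem_cylinder_iff_prefix _ _ hl, (mem_cylinder_iff x (σ n)).1 hxn]
    exact hpre
  have := (hc.position n).2
  rw [hempty] at this
  norm_num at this

theorem bernoulliRandom (hc : CodingPath p K D σ) (hK : 2 ≤ K) :
    BernoulliRandom p (limitSeq σ) := by
  rintro U ⟨hU, hm⟩ hx
  obtain ⟨e, he⟩ := hU.exists_code
  have hmem : e ∈ testCodes p := fun i => by rw [← he]; exact hm i
  exact hc.limitSeq_notMem hK hmem (by rw [← he]; exact Set.mem_iInter.1 hx _)

/-- A sequence that is coded at the odd positions is computable from the coding sequence. -/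
theorem recursiveIn_limitSeq (hc : CodingPath p K D σ) (hp : p < 1) (hK : 2 ≤ K) {y : Cantor}
    (hy : ∀ m, D (2 * m + 1) = y m) : RecursiveIn {oracle (limitSeq σ)} (oracle y) := by
  set x := limitSeq σ with hx
  set z := binaryExpansion p with hz
  -- The path avoids the frequency test as it avoids every test, so initial segments of `x` certify
  -- those of `p`.
  obtain ⟨e, he, hfreq⟩ := exists_frequency_test hp
  obtain ⟨Q, hQ, hQs, hQc⟩ := exists_expansion_certificate hp
    (hfreq x _ (hc.limitSeq_notMem hK he))
  let dec : ℕ → (List Bool × List Bool) × ℕ := fun w => (Encodable.decode w).getD (([], []), 0)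
  have hdec : Primrec dec := Primrec.option_getD.comp Primrec.decode (Primrec.const _)
  have hdh : Primrec fun w => (dec w).1.1 := Primrec.fst.comp (Primrec.fst.comp hdec)
  have hdπ : Primrec fun w => (dec w).1.2 := Primrec.snd.comp (Primrec.fst.comp hdec)
  -- A witness codes a guessed history, a part of the expansion of `p`, and a number that is never
  -- inspected: it only makes the witness, and so the available segment of `x`, large.
  let C : List Bool → ℕ → ℕ → Prop := fun ξ n w =>
    2 * n + 1 < (dec w).1.1.length ∧ K ^ ((dec w).1.1.length + 1) ≤ ξ.length ∧
      Q ξ (dec w).1.2 ∧ ∀ i < (dec w).1.1.length,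
        Decodes K (dec w).1.2 ((dec w).1.1.take i) (ξ.take (K ^ (i + 2)))
          ((dec w).1.1.getD i false)
  refine oracle_recursiveIn_of_certificate C (fun n w => (dec w).1.1.getD (2 * n + 1) false)
    ?_ ?_ ?_ ?_
  · have hw : Primrec fun a : List Bool × ℕ × ℕ => a.2.2 := Primrec.snd.comp Primrec.snd
    have hl : Primrec fun a : List Bool × ℕ × ℕ => (dec a.2.2).1.1.length :=
      Primrec.list_length.comp (hdh.comp hw)
    refine PrimrecPred.and ?_ (PrimrecPred.and ?_ (PrimrecPred.and ?_ ?_))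
    · exact Primrec.nat_lt.comp (Primrec.nat_double_succ.comp (Primrec.fst.comp Primrec.snd)) hl
    · exact Primrec.nat_le.comp (primrec_pow.comp (Primrec.const K) (Primrec.succ.comp hl))
        (Primrec.list_length.comp Primrec.fst)
    · exact hQ.comp (f := fun a : List Bool × ℕ × ℕ => (a.1, (dec a.2.2).1.2))
        (Primrec.fst.pair (hdπ.comp hw))
    · refine primrecPred_forall_lt (R := fun (i : ℕ) (a : List Bool × ℕ × ℕ) =>
        Decodes K (dec a.2.2).1.2 ((dec a.2.2).1.1.take i) (a.1.take (K ^ (i + 2)))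
          ((dec a.2.2).1.1.getD i false)) ?_ hl
      have hw' : Primrec fun b : ℕ × List Bool × ℕ × ℕ => b.2.2.2 := hw.comp Primrec.snd
      refine (primrecPred_decodes K).comp (f := fun b : ℕ × List Bool × ℕ × ℕ =>
        ((dec b.2.2.2).1.2, (dec b.2.2.2).1.1.take b.1, b.2.1.take (K ^ (b.1 + 2)),
          (dec b.2.2.2).1.1.getD b.1 false)) ?_
      refine (hdπ.comp hw').pair ((Primrec.list_take.comp Primrec.fst (hdh.comp hw')).pair
        (Primrec.pair ?_ ((Primrec.list_getD false).comp (hdh.comp hw') Primrec.fst)))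
      exact Primrec.list_take.comp (primrec_pow.comp (Primrec.const K)
        (Primrec.nat_add.comp Primrec.fst (Primrec.const 2)))
        (Primrec.fst.comp Primrec.snd)
  · exact (Primrec.list_getD false).comp (hdh.comp Primrec.snd)
      (Primrec.nat_double_succ.comp Primrec.fst)
  · intro n
    have hk : ∃ k, ∀ i < 2 * n + 2,
        Decodes K (initSeg z k) (initSeg D i) (σ (i + 1)) (D i) := by
      choose f hf using fun i => (hc.next i).decodes
      refine ⟨(Finset.range (2 * n + 2)).sup f, fun i hi => (hf i).mono (initSeg_prefix _ ?_)⟩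
      exact Finset.le_sup (Finset.mem_range.2 hi)
    obtain ⟨k, hk⟩ := hk
    obtain ⟨w₀, hw₀⟩ := hQc k
    set c := max w₀ (K ^ (2 * n + 3)) with hcdef
    refine ⟨Encodable.encode ((initSeg D (2 * n + 2), initSeg z k), c), ?_⟩
    have hdw : dec (Encodable.encode ((initSeg D (2 * n + 2), initSeg z k), c)) =
        ((initSeg D (2 * n + 2), initSeg z k), c) := by simp [dec]
    have hcw : c ≤ Encodable.encode ((initSeg D (2 * n + 2), initSeg z k), c) := by
      rw [Encodable.encode_prod_val]
      exact Nat.right_le_pair _ _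
    set w := Encodable.encode ((initSeg D (2 * n + 2), initSeg z k), c)
    simp only [C, hdw, length_initSeg]
    refine ⟨by omega, ((le_max_right _ _).trans hcw), hw₀ _ ((le_max_left _ _).trans hcw),
      fun i hi => ?_⟩
    have hpow : K ^ (i + 2) ≤ w := (Nat.pow_le_pow_right (by omega) (by omega)).trans
      ((le_max_right _ _).trans hcw)
    rw [take_initSeg _ hi.le, take_initSeg _ hpow, List.getD_eq_getElem?_getD,
      getElem?_initSeg D hi, Option.getD_some, hc.initSeg_limitSeq hK (i + 1)]
    exact hk i hi
  · rintro n w ⟨h₁, h₂, h₃, h₄⟩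
    rw [length_initSeg] at h₂
    generalize (dec w).1.1 = h at *
    generalize (dec w).1.2 = π at *
    have hπ := hQs w π h₃
    -- Soundness goes by induction along the history: the meaning of the next code word depends on
    -- the previous bits being right, and for a correct history and oracle part the wrong bit is
    -- never decoded.
    have key : ∀ i ≤ h.length, h.take i = initSeg D i := by
      intro i
      induction i with
      | zero => intro _; simp [initSeg]
      | succ i ih =>
        intro hi
        have hi' : i < h.length := hi
        have hd := h₄ i hi'
        have hpow : K ^ (i + 2) ≤ w := (Nat.pow_le_pow_right (by omega) (by omega)).trans h₂
        rw [ih hi'.le, take_initSeg _ hpow, hc.initSeg_limitSeq hK (i + 1), hπ] at hd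
        have hbit : h.getD i false = D i := by
          by_contra hne
          rw [Bool.eq_not_of_ne hne] at hd
          exact (hc.next i).not_decodes _ hd
        rw [initSeg_succ, ← ih hi'.le, ← hbit, List.take_succ_eq_append_getElem hi',
          List.getD_eq_getElem _ _ hi']
    have hfull := key h.length le_rfl
    rw [List.take_length] at hfull
    change h.getD (2 * n + 1) false = y n
    rw [hfull, List.getD_eq_getElem?_getD, getElem?_initSeg D h₁, Option.getD_some, hy]

end CodingPath

/-! ### Building two sequences that code each other -/

open Classical in
/-- The bit to be coded after the history `h`: whether a number is the code of a test, or the next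
bit of the partner, which has reached the position `τ`. -/
noncomputable def nextBit (p : unitInterval) (h τ : List Bool) : Bool :=
  if h.length % 2 = 0 then decide (h.length / 2 ∈ testCodes p) else τ.getD (h.length / 2) false

theorem nextBit_mem_testCodes {p : unitInterval} {h τ : List Bool}
    (hb : nextBit p h τ = true) (e : ℕ) (he : h.length = 2 * e) : e ∈ testCodes p := by
  rw [nextBit, if_pos (by omega), he] at hb
  simpa using hb

/-- Two sequences, each of which codes the other one. -/
theorem exists_codingPaths {p q : unitInterval} (hp : p < 1) (hq : q < 1) {M N : ℕ}
    (hM₀ : 1 ≤ M * (p : ℝ)) (hM₁ : 1 ≤ M * (1 - (p : ℝ)))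
    (hN₀ : 1 ≤ N * (q : ℝ)) (hN₁ : 1 ≤ N * (1 - (q : ℝ))) :
    ∃ (D E : Cantor) (σ τ : ℕ → List Bool), CodingPath p (4 * M) D σ ∧
      CodingPath q (4 * N) E τ ∧
      ∀ m, D (2 * m + 1) = limitSeq τ m ∧ E (2 * m + 1) = limitSeq σ m := by
  -- A state holds both histories and both strings; the invariants are part of the type, so that a
  -- next state always exists.
  let S := {s : (List Bool × List Bool) × List Bool × List Bool //
    Position p (4 * M) s.1.1 s.1.2 ∧ Position q (4 * N) s.2.1 s.2.2}
  have hstep : ∀ s : S, ∃ s' : S,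
      (s'.1.1.1 = s.1.1.1 ++ [nextBit p s.1.1.1 s.1.2.2] ∧
        NextPosition p (4 * M) s.1.1.1 s.1.1.2 (nextBit p s.1.1.1 s.1.2.2) s'.1.1.2) ∧
      (s'.1.2.1 = s.1.2.1 ++ [nextBit q s.1.2.1 s.1.1.2] ∧
        NextPosition q (4 * N) s.1.2.1 s.1.2.2 (nextBit q s.1.2.1 s.1.1.2) s'.1.2.2) := by
    rintro ⟨⟨⟨h, σ⟩, g, τ⟩, hσ, hτ⟩
    -- Both new bits are read from the old state, so the mutual coding is not circular.
    obtain ⟨σ', h₁, h₂, h₃, h₄⟩ := hσ.exists_next hp hM₀ hM₁ (b := nextBit p h τ)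
      nextBit_mem_testCodes
    obtain ⟨τ', k₁, k₂, k₃, k₄⟩ := hτ.exists_next hq hN₀ hN₁ (b := nextBit q g σ)
      nextBit_mem_testCodes
    exact ⟨⟨((h ++ [nextBit p h τ], σ'), g ++ [nextBit q g σ], τ'), h₂, k₂⟩,
      ⟨rfl, ⟨h₁, h₂, h₃, h₄⟩⟩, ⟨rfl, ⟨k₁, k₂, k₃, k₄⟩⟩⟩
  choose next hnext₁ hnext₂ using hstep
  obtain ⟨σ₀, hσ₀⟩ := exists_position_nil p (4 * M)
  obtain ⟨τ₀, hτ₀⟩ := exists_position_nil q (4 * N)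
  let s : ℕ → S := fun n => Nat.rec ⟨(([], σ₀), [], τ₀), hσ₀, hτ₀⟩ (fun _ s => next s) n
  have hs : ∀ n, s (n + 1) = next (s n) := fun _ => rfl
  set D : Cantor := fun n => nextBit p (s n).1.1.1 (s n).1.2.2 with hD
  set E : Cantor := fun n => nextBit q (s n).1.2.1 (s n).1.1.2 with hE
  have hDs : ∀ n, (s n).1.1.1 = initSeg D n := by
    intro n
    induction n with
    | zero => rfl
    | succ n ih => rw [initSeg_succ, ← ih, hs, (hnext₁ _).1]
  have hEs : ∀ n, (s n).1.2.1 = initSeg E n := by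
    intro n
    induction n with
    | zero => rfl
    | succ n ih => rw [initSeg_succ, ← ih, hs, (hnext₂ _).1]
  have hDn : ∀ n, D n = nextBit p (initSeg D n) (s n).1.2.2 := fun n => by
    rw [← hDs]
  have hEn : ∀ n, E n = nextBit q (initSeg E n) (s n).1.1.2 := fun n => by
    rw [← hEs]
  have cD : CodingPath p (4 * M) D fun n => (s n).1.1.2 := by
    refine ⟨fun n => ?_, fun n => ?_, fun e => ?_⟩
    · rw [← hDs]; exact (s n).2.1
    · rw [← hDs]; exact (hnext₁ (s n)).2
    · rw [hDn, nextBit, length_initSeg, if_pos (by omega)]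
      simp
  have cE : CodingPath q (4 * N) E fun n => (s n).1.2.2 := by
    refine ⟨fun n => ?_, fun n => ?_, fun e => ?_⟩
    · rw [← hEs]; exact (s n).2.2
    · rw [← hEs]; exact (hnext₂ (s n)).2
    · rw [hEn, nextBit, length_initSeg, if_pos (by omega)]
      simp
  have hM : 2 ≤ 4 * M := by
    rcases Nat.eq_zero_or_pos M with rfl | h
    · norm_num at hM₀
    · omega
  have hN : 2 ≤ 4 * N := by
    rcases Nat.eq_zero_or_pos N with rfl | h
    · norm_num at hN₀
    · omega
  refine ⟨D, E, _, _, cD, cE, fun m => ⟨?_, ?_⟩⟩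
  -- At stage `2 * m + 1` the string of the partner is already longer than `m`, so the coded bit is
  -- a final one and not the default value of `getD`.
  · have hl := cE.lt_length hN (2 * m + 1)
    refine (hDn (2 * m + 1)).trans ?_
    rw [nextBit, length_initSeg, if_neg (by omega),
      show (2 * m + 1) / 2 = m by omega]
    exact cE.getD_eq_limitSeq hN (n := 2 * m + 1) (lt_of_le_of_lt (by omega) hl)
  · have hl := cD.lt_length hM (2 * m + 1)
    refine (hEn (2 * m + 1)).trans ?_
    rw [nextBit, length_initSeg, if_neg (by omega),
      show (2 * m + 1) / 2 = m by omega]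
    exact cD.getD_eq_limitSeq hM (n := 2 * m + 1) (lt_of_le_of_lt (by omega) hl)

/-! ### Random sequences of equal degree for given parameters -/

theorem exists_nat_one_le_mul {p : unitInterval} (hp₀ : 0 < p) (hp₁ : p < 1) :
    ∃ N : ℕ, 1 ≤ N * (p : ℝ) ∧ 1 ≤ N * (1 - (p : ℝ)) := by
  have h₀ : (0 : ℝ) < p := hp₀
  have h₁ : (0 : ℝ) < 1 - p := sub_pos.2 hp₁
  obtain ⟨N, hN⟩ := exists_nat_ge (max (p : ℝ)⁻¹ (1 - (p : ℝ))⁻¹)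
  rw [max_le_iff, inv_le_iff_one_le_mul₀ h₀, inv_le_iff_one_le_mul₀ h₁] at hN
  exact ⟨N, hN⟩

/-- For any two parameters there are random sequences of the same Turing degree. -/
theorem exists_bernoulliRandom_turingEquiv {p q : unitInterval} (hp₀ : 0 < p) (hp₁ : p < 1)
    (hq₀ : 0 < q) (hq₁ : q < 1) :
    ∃ x y, BernoulliRandom p x ∧ BernoulliRandom q y ∧ TuringEquiv x y := by
  obtain ⟨M, hM₀, hM₁⟩ := exists_nat_one_le_mul hp₀ hp₁
  obtain ⟨N, hN₀, hN₁⟩ := exists_nat_one_le_mul hq₀ hq₁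
  obtain ⟨D, E, σ, τ, cD, cE, hDE⟩ := exists_codingPaths hp₁ hq₁ hM₀ hM₁ hN₀ hN₁
  have hM : 2 ≤ 4 * M := by
    rcases Nat.eq_zero_or_pos M with rfl | h
    · norm_num at hM₀
    · omega
  have hN : 2 ≤ 4 * N := by
    rcases Nat.eq_zero_or_pos N with rfl | h
    · norm_num at hN₀
    · omega
  exact ⟨limitSeq σ, limitSeq τ, cD.bernoulliRandom hM, cE.bernoulliRandom hN,
    cE.recursiveIn_limitSeq hq₁ hN fun m => (hDE m).2,
    cD.recursiveIn_limitSeq hp₁ hM fun m => (hDE m).1⟩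

/-- Enlarging the oracle only adds tests. This discards the expansion of `1/2`, relative to which
the second sequence was made random. -/
theorem PassesMLTests.mono {μ : Measure Cantor} {O O' : Set (ℕ →. ℕ)} {x : Cantor}
    (h : PassesMLTests μ O' x) (hO : O ⊆ O') : PassesMLTests μ O x := by
  rintro U ⟨⟨f, hf, hU⟩, hm⟩
  exact h U ⟨⟨f, RecursiveIn.mono hO hf, hU⟩, hm⟩

end BernoulliRandomness

theorem mainTheorem7 (p : unitInterval) (hp₀ : 0 < p) (hp₁ : p < 1) :
    ∃ x y : BernoulliRandomness.Cantor, BernoulliRandomness.BernoulliRandom p x ∧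
      BernoulliRandomness.MLRandom y ∧ BernoulliRandomness.TuringEquiv x y := by
  obtain ⟨x, y, hx, hy, hxy⟩ := BernoulliRandomness.exists_bernoulliRandom_turingEquiv hp₀ hp₁
    (q := ⟨1 / 2, by norm_num, by norm_num⟩) (Subtype.mk_lt_mk.2 (by norm_num))
    (Subtype.mk_lt_mk.2 (by norm_num))
  exact ⟨x, y, hx, hy.mono (Set.empty_subset _), hxy⟩
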